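/- **Setting.** Let $G_1,G_2$ be (Hausdorff) locally compact abelian groups with Haar measures $du,dv$, and let $1<p,q<\infty$. For $A\subset G_1$, $B\subset G_2$ put $$\|f\|_{L^{p,q}(A\times B)}=\Big(\int_A\Big(\int_B|f(u,v)|^q\,dv\Big)^{p/q}du\Big)^{1/p},$$ and let $L^{p,q}(G_1\times G_2)$ be the space of measurable $f:G_1\times G_2\to\mathbb C$ with $\|f\|_{L^{p,q}(G_1\times G_2)}<\infty$. Let $I$ be a countable index set and let $(x_s)_{s\in I}\subset G_1$, $(y_t)_{t\in I}\subset G_2$ be separated: there are neighbourhoods $U_1,U_2$ of the identities such that the sets $x_s+U_1$ are pairwise disjoint, and so are the sets $y_t+U_2$. For $\mathbf c=(c_1,\dots,c_r)$ with $c_i:I\times I\to\mathbb C$ let $\|\mathbf c\|_{\ell^{p,q}}=\sum_{i=1}^r\big(\sum_s(\sum_t|c_i(s,t)|^q)^{p/q}\big)^{1/p}$; $(\ell^{p,q})^r$ is the set of those $\mathbf c$ for which this is finite. Assume: * (A1) $\omega\in L^1(G_1\times G_2)$ has its support in $W=W_1\times W_2$, where $W_1\subset G_1$, $W_2\subset G_2$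 are compact and contain the identities. * (A2) $K=K_1\times K_2$ with $K_1\subset G_1$, $K_2\subset G_2$ compact, of Haar measures $\mu_1,\mu_2$, and $\widetilde K=K-W$. The functions $\phi_1,\dots,\phi_r$ on $G_1\times G_2$ are continuous with compact support, $\Phi=(\phi_1,\dots,\phi_r)^T$, and there are $0<a_1\le a_2<\infty$ with $$a_1\|\mathbf c\|_{\ell^{p,q}}\le\Big\|\sum_{s,t}\mathbf c(s,t)^T\Phi(\cdot-x_s,\cdot-y_t)\Big\|_{L^{p,q}(\widetilde K)}\le a_2\|\mathbf c\|_{\ell^{p,q}}$$ for all $\mathbf c\in(\ell^{p,q})^r$ such that $\mathbf c(s,t)=0$ whenever $\Phi(\cdot-x_s,\cdot-y_t)\equiv0$ on $\widetilde K$. Call such $\mathbf c$ admissible. * (A3) With $\operatorname{supp}$ the closed support, $\widetilde K-\bigcup_{i}\operatorname{supp}\phi_i$ is sequentially compact. * (A4) $\rho$ is a probability density over $K$ (with respect to $du\,dv$) with $0<\mathcal C_{\rho,1}\le\rho\le\mathcal C_{\rho,2}$ on $K$. Let $$V_K(\Phi)=\Big\{f\in L^{p,q}(G_1\times G_2):\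 f=\sum_{s,t}\mathbf c(s,t)^T\Phi(\cdot-x_s,\cdot-y_t)\text{ on }\widetilde K\text{ for some }\mathbf c\in(\ell^{p,q})^r\Big\},$$ let $d$ be its real dimension as a space of functions on $\widetilde K$, and put $\widetilde C_\Phi=\sup_{(u,v)\in\widetilde K}\sum_{i}\sum_{s,t}|\phi_i(u-x_s,v-y_t)|$ and $\|\omega\|=\|\omega\|_{L^1(W)}$. Let $(u_{jk},v_{jk})$, $j,k\in\mathbb N$, be independent random points of $K$ (one point for each pair $(j,k)$), each with density $\rho$. For $\gamma\in(0,1)$ and $\zeta>0$ put $$N_{\zeta,\gamma}=\gamma\,\mathcal C_{\rho,1}\,\mu_1^{1-q}\mu_2^{1-p}\Big(\frac{\widetilde C_\Phi}{a_1}\|\omega\|\Big)^{1-pq}\zeta^{pq},\qquad X_{\zeta,\gamma}=\gamma\,\mathcal C_{\rho,1}\Big(\frac{a_1\zeta}{\widetilde C_\Phi\|\omega\|}\Big)^{pq},$$ $$\beta'_{\zeta,\gamma}=\frac{\mu_1^{1-q}\mu_2^{1-p}\big(\tfrac{\sqrt3}{2}X_{\zeta,\gamma}\big)^2}{6\mu_1^{q-1}\mu_2^{p-1}+X_{\zeta,\gamma}},\qquad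 \beta''_{\zeta,\gamma}=\frac{\mu_1^{1-q}\mu_2^{1-p}\big(X_{\zeta,\gamma}\widetilde C_\Phi/a_1\big)^2}{72\sqrt2\,\big(81\mu_1^{q-1}\mu_2^{p-1}+X_{\zeta,\gamma}\widetilde C_\Phi/a_1\big)},$$ $$\mathcal A_1=2\exp\Big(d\ln\frac{8\widetilde C_\Phi}{a_1}\Big),\qquad \mathcal A_2=\frac{4}{3d(\ln2)^2}\Big(\frac{4\widetilde C_\Phi}{a_1}\Big)^{2d}.$$ (If $d=0$, read $\mathcal A_1=2$, $\mathcal A_2=0$, and the right-hand side of the condition on $nm$ below as $0$.) **Theorem.** Assume (A1)–(A4), and suppose that there is $\beta>0$ with $$\Big\|\sum_{s,t}\mathbf c(s,t)^T(\Phi*\omega)(\cdot-x_s,\cdot-y_t)\Big\|_{L^{p,q}(K)}\ge\beta\|\mathbf c\|_{\ell^{p,q}}\qquad\text{for all admissible }\mathbf c.$$ Let $\gamma\in(0,1)$, $\zeta=\beta/a_2$, and let $n,m\in\mathbb N$ satisfy $$nm>\frac{108\sqrt2\,(\ln2)\,d\,\|\omega\|}{N_{\zeta,\gamma}^2}\,\big(162\|\omega\|+2N_{\zeta,\gamma}\big).$$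 Then, with probability at least $1-\mathcal A_1e^{-nm\beta'_{\zeta,\gamma}}-\mathcal A_2e^{-nm\beta''_{\zeta,\gamma}}$, there are functions $h_{j,k}$, depending on the sampling points but not on $f$, such that for every $f\in V_K(\Phi)$ $$f(u,v)=\sum_{j=1}^n\sum_{k=1}^m(f*\omega)(u_{jk},v_{jk})\,h_{j,k}(u,v),\qquad(u,v)\in\widetilde K.$$ Moreover, on the same event these functions can be taken as follows. Let $J$ be the finite set of pairs $(s,t)$ for which $\Phi(\cdot-x_s,\cdot-y_t)\not\equiv0$ on $\widetilde K$, and let $M$ be the matrix with rows indexed by $(j,k)$, columns indexed by $(s,t,i)$ with $(s,t)\in J$, $1\le i\le r$, and entries $(\phi_i*\omega)(u_{jk}-x_s,v_{jk}-y_t)$. Then $M$ is injective, and with $M^+=(M^*M)^{-1}M^*$ one may take $$h_{j,k}=\sum_{(s,t)\in J}\sum_{i=1}^r(M^+)_{(s,t,i),(j,k)}\,\phi_i(\cdot-x_s,\cdot-y_t).$$ -/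

import Mathlib

open MeasureTheory ProbabilityTheory Set
open scoped ENNReal Matrix Pointwise Topology

namespace RandomAverageSampling

noncomputable section

/-! ### Mixed norms and convolution on a product of two groups -/

/-- The mixed norm `‖f‖_{L^{p,q}(A × B)} = (∫_A (∫_B |f(u,v)|^q dv)^{p/q} du)^{1/p}`,
with values in `[0, ∞]`. For `p = q = 1` it is the `L¹` norm over `A × B`. -/
def mixedNorm {G₁ G₂ : Type*} [MeasurableSpace G₁] [MeasurableSpace G₂]
    (μ₁ : Measure G₁) (μ₂ : Measure G₂) (p q : ℝ) (A : Set G₁) (B : Set G₂)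
    (f : G₁ × G₂ → ℂ) : ℝ≥0∞ :=
  (∫⁻ u in A, (∫⁻ v in B, ‖f (u, v)‖ₑ ^ q ∂μ₂) ^ (p / q) ∂μ₁) ^ (1 / p)

/-- `f ∈ L^{p,q}(G₁ × G₂)`: measurable with finite mixed norm. -/
def MemMixedLp {G₁ G₂ : Type*} [MeasurableSpace G₁] [MeasurableSpace G₂]
    (μ₁ : Measure G₁) (μ₂ : Measure G₂) (p q : ℝ) (f : G₁ × G₂ → ℂ) : Prop :=
  Measurable f ∧ mixedNorm μ₁ μ₂ p q univ univ f < ∞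

/-- The convolution `(f * w)(u,v) = ∫∫ f(u - u', v - v') w(u',v') dv' du'`. The Haar integral of
the product group is written as an iterated integral, so that no countability assumption on the
groups is needed. -/
def conv {G₁ G₂ : Type*} [AddCommGroup G₁] [AddCommGroup G₂]
    [MeasurableSpace G₁] [MeasurableSpace G₂] (μ₁ : Measure G₁) (μ₂ : Measure G₂)
    (f w : G₁ × G₂ → ℂ) (z : G₁ × G₂) : ℂ :=
  ∫ u, ∫ v, f (z - (u, v)) * w (u, v) ∂μ₂ ∂μ₁

/-! ### Coefficient sequences and sums of shifts -/

/-- The norm of `ℓ^{p,q}`, with values in `[0, ∞]`. -/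
def seqNorm {I : Type*} (p q : ℝ) (c : I → I → ℂ) : ℝ≥0∞ :=
  (∑' s, (∑' t, ‖c s t‖ₑ ^ q) ^ (p / q)) ^ (1 / p)

/-- The norm of `(ℓ^{p,q})^r`, the sum of the norms of the components. -/
def vecSeqNorm {I : Type*} {r : ℕ} (p q : ℝ) (c : Fin r → I → I → ℂ) : ℝ≥0∞ :=
  ∑ i, seqNorm p q (c i)

/-- A family of points is separated: for some neighbourhood `U` of `0`, the translates `x i + U`
are pairwise disjoint. -/
def IsSeparatedFamily {I G : Type*} [AddCommGroup G] [TopologicalSpace G] (x : I → G) : Prop :=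
  ∃ U ∈ 𝓝 (0 : G), Pairwise fun i j => Disjoint ((x i + ·) '' U) ((x j + ·) '' U)

/-- The value at `z` of `∑_{s,t} c(s,t)ᵀ Ψ(· - x_s, · - y_t)`. -/
def shiftSum {I G₁ G₂ : Type*} [AddCommGroup G₁] [AddCommGroup G₂] {r : ℕ}
    (Ψ : Fin r → G₁ × G₂ → ℂ) (x : I → G₁) (y : I → G₂) (c : Fin r → I → I → ℂ)
    (z : G₁ × G₂) : ℂ :=
  ∑' st : I × I, ∑ i, c i st.1 st.2 * Ψ i (z - (x st.1, y st.2))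

/-- The index pairs `(s,t)` for which `Φ(· - x_s, · - y_t)` is not identically zero on `D`. -/
def activeSet {I G₁ G₂ : Type*} [AddCommGroup G₁] [AddCommGroup G₂] {r : ℕ}
    (Φ : Fin r → G₁ × G₂ → ℂ) (x : I → G₁) (y : I → G₂) (D : Set (G₁ × G₂)) : Set (I × I) :=
  {st | ∃ z ∈ D, ∃ i, Φ i (z - (x st.1, y st.2)) ≠ 0}

/-- The `c ∈ (ℓ^{p,q})^r` with `c(s,t) = 0` whenever `Φ(· - x_s, · - y_t) ≡ 0` on `D`. -/
def coeffSpace {I G₁ G₂ : Type*} [AddCommGroup G₁] [AddCommGroup G₂] {r : ℕ} (p q : ℝ)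
    (Φ : Fin r → G₁ × G₂ → ℂ) (x : I → G₁) (y : I → G₂) (D : Set (G₁ × G₂)) :
    Set (Fin r → I → I → ℂ) :=
  {c | vecSeqNorm p q c < ∞ ∧ ∀ s t, (s, t) ∉ activeSet Φ x y D → ∀ i, c i s t = 0}

/-! ### The standing assumptions -/

/-- `w ∈ L¹(G₁ × G₂)` vanishes outside `W₁ × W₂`, where `W₁`, `W₂` are compact and contain `0`. -/
structure IsAveragingFunction {G₁ G₂ : Type*} [AddCommGroup G₁] [AddCommGroup G₂]
    [TopologicalSpace G₁] [TopologicalSpace G₂] [MeasurableSpace G₁] [MeasurableSpace G₂]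
    (μ₁ : Measure G₁) (μ₂ : Measure G₂) (w : G₁ × G₂ → ℂ) (W₁ : Set G₁) (W₂ : Set G₂) :
    Prop where
  compact₁ : IsCompact W₁
  compact₂ : IsCompact W₂
  zero_mem₁ : (0 : G₁) ∈ W₁
  zero_mem₂ : (0 : G₂) ∈ W₂
  integrable : MemMixedLp μ₁ μ₂ 1 1 w
  support_subset : Function.support w ⊆ W₁ ×ˢ W₂

/-- The components of `Φ` are continuous with compact support (hence in `L^{p,q}`), and the shifts
of `Φ` are stable on `A × B` with constants `0 < a₁ ≤ a₂`. -/
structure HasStableShifts {I G₁ G₂ : Type*} [AddCommGroup G₁] [AddCommGroup G₂]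
    [TopologicalSpace G₁] [TopologicalSpace G₂] [MeasurableSpace G₁] [MeasurableSpace G₂] {r : ℕ}
    (μ₁ : Measure G₁) (μ₂ : Measure G₂) (p q : ℝ) (Φ : Fin r → G₁ × G₂ → ℂ)
    (x : I → G₁) (y : I → G₂) (A : Set G₁) (B : Set G₂) (a₁ a₂ : ℝ) : Prop where
  continuous : ∀ i, Continuous (Φ i)
  compactSupport : ∀ i, HasCompactSupport (Φ i)
  pos : 0 < a₁
  le : a₁ ≤ a₂
  lower : ∀ c ∈ coeffSpace p q Φ x y (A ×ˢ B),
    ENNReal.ofReal a₁ * vecSeqNorm p q c ≤ mixedNorm μ₁ μ₂ p q A B (shiftSum Φ x y c)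
  upper : ∀ c ∈ coeffSpace p q Φ x y (A ×ˢ B),
    mixedNorm μ₁ μ₂ p q A B (shiftSum Φ x y c) ≤ ENNReal.ofReal a₂ * vecSeqNorm p q c

/-- The measure on `G₁ × G₂` with density `ρ` over `K₁ × K₂` with respect to Haar measure. -/
def sampleLaw {G₁ G₂ : Type*} [MeasurableSpace G₁] [MeasurableSpace G₂]
    (μ₁ : Measure G₁) (μ₂ : Measure G₂) (K₁ : Set G₁) (K₂ : Set G₂) (ρ : G₁ × G₂ → ℝ) :
    Measure (G₁ × G₂) :=
  ((μ₁.restrict K₁).prod (μ₂.restrict K₂)).withDensity fun z => ENNReal.ofReal (ρ z)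

/-- `ρ` is a probability density over `K₁ × K₂` with `0 < C₁ ≤ ρ ≤ C₂` there. -/
structure IsBoundedDensity {G₁ G₂ : Type*} [MeasurableSpace G₁] [MeasurableSpace G₂]
    (μ₁ : Measure G₁) (μ₂ : Measure G₂) (K₁ : Set G₁) (K₂ : Set G₂) (ρ : G₁ × G₂ → ℝ)
    (C₁ C₂ : ℝ) : Prop where
  measurable : Measurable ρ
  total : sampleLaw μ₁ μ₂ K₁ K₂ ρ univ = 1
  pos : 0 < C₁
  lower : ∀ z ∈ K₁ ×ˢ K₂, C₁ ≤ ρ z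
  upper : ∀ z ∈ K₁ ×ˢ K₂, ρ z ≤ C₂

/-! ### The local quasi shift-invariant space -/

/-- The space of all `f ∈ L^{p,q}(G₁ × G₂)` that agree on `D` with some
`∑_{s,t} c(s,t)ᵀ Φ(· - x_s, · - y_t)`, `c ∈ (ℓ^{p,q})^r`. -/
def localSpace {I G₁ G₂ : Type*} [AddCommGroup G₁] [AddCommGroup G₂]
    [MeasurableSpace G₁] [MeasurableSpace G₂] {r : ℕ}
    (μ₁ : Measure G₁) (μ₂ : Measure G₂) (p q : ℝ) (Φ : Fin r → G₁ × G₂ → ℂ)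
    (x : I → G₁) (y : I → G₂) (D : Set (G₁ × G₂)) : Set (G₁ × G₂ → ℂ) :=
  {f | MemMixedLp μ₁ μ₂ p q f ∧
    ∃ c : Fin r → I → I → ℂ, vecSeqNorm p q c < ∞ ∧ ∀ z ∈ D, f z = shiftSum Φ x y c z}

/-- The real dimension of the local space, regarded as a space of functions on `D`. -/
def localDim {I G₁ G₂ : Type*} [AddCommGroup G₁] [AddCommGroup G₂]
    [MeasurableSpace G₁] [MeasurableSpace G₂] {r : ℕ}
    (μ₁ : Measure G₁) (μ₂ : Measure G₂) (p q : ℝ) (Φ : Fin r → G₁ × G₂ → ℂ)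
    (x : I → G₁) (y : I → G₂) (D : Set (G₁ × G₂)) : ℕ :=
  Set.finrank ℝ ((fun f : G₁ × G₂ → ℂ => D.domRestrict f) '' localSpace μ₁ μ₂ p q Φ x y D)

/-- `sup_{z ∈ D} ∑_i ∑_{s,t} |φ_i(z - (x_s, y_t))|`. -/
def shiftSup {I G₁ G₂ : Type*} [AddCommGroup G₁] [AddCommGroup G₂] {r : ℕ}
    (Φ : Fin r → G₁ × G₂ → ℂ) (x : I → G₁) (y : I → G₂) (D : Set (G₁ × G₂)) : ℝ :=
  ⨆ z : D, ∑ i, ∑' st : I × I, ‖Φ i (z.1 - (x st.1, y st.2))‖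

/-! ### The constants

Here `d` is the dimension, `Ct` is the supremum `shiftSup`, `Nw` is the `L¹` norm of the averaging
function, `m₁`, `m₂` are the Haar measures of `K₁`, `K₂`, and `C` is the lower bound of the
density. -/

/-- The quantity `γ C m₁^{1-q} m₂^{1-p} (Ct Nw / a₁)^{1-pq} ζ^{pq}`. -/
def thresholdConst (p q m₁ m₂ a₁ Ct Nw C γ ζ : ℝ) : ℝ :=
  γ * C * m₁ ^ (1 - q) * m₂ ^ (1 - p) * (Ct / a₁ * Nw) ^ (1 - p * q) * ζ ^ (p * q)

/-- The lower bound for the number of samples. -/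
def sampleBound (p q m₁ m₂ a₁ Ct Nw C γ ζ : ℝ) (d : ℕ) : ℝ :=
  108 * √2 * Real.log 2 * d * Nw / thresholdConst p q m₁ m₂ a₁ Ct Nw C γ ζ ^ 2 *
    (162 * Nw + 2 * thresholdConst p q m₁ m₂ a₁ Ct Nw C γ ζ)

/-- `𝒜₁ = 2 exp(d ln(8 Ct / a₁))`. -/
def probConst₁ (a₁ Ct : ℝ) (d : ℕ) : ℝ :=
  2 * Real.exp (d * Real.log (8 * Ct / a₁))

/-- `𝒜₂ = 4 / (3 d (ln 2)²) (4 Ct / a₁)^{2d}`. -/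
def probConst₂ (a₁ Ct : ℝ) (d : ℕ) : ℝ :=
  4 / (3 * d * Real.log 2 ^ 2) * (4 * Ct / a₁) ^ (2 * d)

/-- The exponent `β'_{ζ,γ}`. -/
def rate₁ (p q m₁ m₂ a₁ Ct Nw C γ ζ : ℝ) : ℝ :=
  m₁ ^ (1 - q) * m₂ ^ (1 - p) *
      (√3 / 2 * γ * C * (a₁ * ζ / (Ct * Nw)) ^ (p * q)) ^ 2 /
    (6 * m₁ ^ (q - 1) * m₂ ^ (p - 1) + γ * C * (a₁ * ζ / (Ct * Nw)) ^ (p * q))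

/-- The exponent `β''_{ζ,γ}`. -/
def rate₂ (p q m₁ m₂ a₁ Ct Nw C γ ζ : ℝ) : ℝ :=
  m₁ ^ (1 - q) * m₂ ^ (1 - p) *
      (γ * C * (a₁ * ζ / (Ct * Nw)) ^ (p * q) * (Ct / a₁)) ^ 2 /
    (72 * √2 *
      (81 * m₁ ^ (q - 1) * m₂ ^ (p - 1) +
        γ * C * (a₁ * ζ / (Ct * Nw)) ^ (p * q) * (Ct / a₁)))

/-! ### The sampling matrix and the least-squares reconstruction functions -/

open Classical in
/-- The active index pairs as a finite set (a junk value if there are infinitely many). -/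
def activeFinset {I G₁ G₂ : Type*} [AddCommGroup G₁] [AddCommGroup G₂] {r : ℕ}
    (Φ : Fin r → G₁ × G₂ → ℂ) (x : I → G₁) (y : I → G₂) (D : Set (G₁ × G₂)) : Finset (I × I) :=
  if h : (activeSet Φ x y D).Finite then h.toFinset else ∅

/-- The matrix with entries `(φ_i * w)(z_{jk} - (x_s, y_t))`; its rows are indexed by the sampling
points, and its columns by the active pairs `(s,t)` and the components `i`. -/
def samplingMatrix {I G₁ G₂ : Type*} [AddCommGroup G₁] [AddCommGroup G₂]
    [MeasurableSpace G₁] [MeasurableSpace G₂] {r n m : ℕ}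
    (μ₁ : Measure G₁) (μ₂ : Measure G₂) (Φ : Fin r → G₁ × G₂ → ℂ) (w : G₁ × G₂ → ℂ)
    (x : I → G₁) (y : I → G₂) (D : Set (G₁ × G₂)) (z : Fin n → Fin m → G₁ × G₂) :
    Matrix (Fin n × Fin m) (activeFinset Φ x y D × Fin r) ℂ :=
  Matrix.of fun jk a => conv μ₁ μ₂ (Φ a.2) w (z jk.1 jk.2 - (x a.1.1.1, y a.1.1.2))

open Classical in
/-- The least-squares pseudo-inverse `(M* M)⁻¹ M*`. -/
def leastSquaresInverse {κ ι : Type*} [Fintype κ] [Fintype ι] (M : Matrix κ ι ℂ) :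
    Matrix ι κ ℂ :=
  (Mᴴ * M)⁻¹ * Mᴴ

/-- The functions `h_{j,k}`: the columns of the pseudo-inverse of the sampling matrix, used as
coefficients of the shifts of `Φ`. -/
def reconFun {I G₁ G₂ : Type*} [AddCommGroup G₁] [AddCommGroup G₂]
    [MeasurableSpace G₁] [MeasurableSpace G₂] {r n m : ℕ}
    (μ₁ : Measure G₁) (μ₂ : Measure G₂) (Φ : Fin r → G₁ × G₂ → ℂ) (w : G₁ × G₂ → ℂ)
    (x : I → G₁) (y : I → G₂) (D : Set (G₁ × G₂)) (z : Fin n → Fin m → G₁ × G₂)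
    (j : Fin n) (k : Fin m) (g : G₁ × G₂) : ℂ :=
  ∑ a : activeFinset Φ x y D × Fin r,
    leastSquaresInverse (samplingMatrix μ₁ μ₂ Φ w x y D z) a (j, k) *
      Φ a.2 (g - (x a.1.1.1, y a.1.1.2))

end

end RandomAverageSampling

open RandomAverageSampling

/-!
Random sampling by the least-squares matrix. A combination of the shifts of `Φ` restricted to the
enlarged domain involves only the finitely many active pairs `(s, t)`: these correspond to points
of separated families lying in a compact set. If the sampling matrix `M` has trivial kernel, then
`(M* M)⁻¹ M*` is a left inverse of `M`, so it recovers the coefficients of `f`, and hence `f` on the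
enlarged domain, from the averaged samples (`eq_sum_conv_mul_reconFun`). It remains to bound the
probability that `M` has a nontrivial kernel.

Let `a ≠ 0` be a coefficient vector and `F` the corresponding combination of the averaged shifts.
On `K₁ × K₂` one has `|F| ≤ Ct Nw ‖a‖`, while `‖F‖_{L^{p,q}} ≥ β ‖a‖` by assumption. Hence `F` cannot
vanish on too large a set (`mixedNorm_rpow_le`, by Jensen's inequality), and since the density is at
least `C₁`, a random point satisfies `F ≠ 0` with probability at least
`X = m₁^{1-q} m₂^{1-p} γ C₁ (a₁ ζ / (Ct Nw))^{pq}`. Reveal the sampling points one at a time, and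
consider the space of coefficient vectors whose averaged combination vanishes at all points seen so
far. As long as this space is nontrivial, each new point lowers its dimension with probability at
least `X`, so the expectation of `2 ^ dim` on the event that it is nontrivial shrinks by the factor
`1 - X / 2`. For `N = nm` points the kernel is therefore nontrivial with probability at most
`2 ^ D (1 - X / 2) ^ N`, where `D` is the number of coefficients
(`measure_commonKernelSet_le`).

Finally, `D ≤ d` by stability of the shifts (`card_le_localDim`), the exponent `rate₁` is at most
`X / 8` because `X ≤ 1` (`rate₁_le`), and the lower bound on `nm` gives
`nm X ≥ d (a₁ / Ct) ^ 2`, which makes `2 ^ D (1 - X / 2) ^ N` at most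
`2 (8 Ct / a₁) ^ d exp (-nm rate₁)` (`two_pow_mul_one_sub_pow_le`). So the first of the two error
terms alone bounds the probability of failure.
-/

namespace RandomAverageSampling

/-! ### Random linear functionals without a common kernel -/

section Kernel

variable {Z ι : Type*} [Fintype ι]

/-- The samples `z₁, …, z_N` at which all functions of some nonzero member of the coefficient space
`V` vanish: there is `c ∈ V`, `c ≠ 0`, with `∑ₐ cₐ gₐ(zᵢ) = 0` for all `i`. -/
def commonKernelSet (g : Z → ι → ℂ) (V : Submodule ℂ (ι → ℂ)) (N : ℕ) : Set (Fin N → Z) :=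
  {z | ∃ c ∈ V, c ≠ 0 ∧ ∀ i, c ⬝ᵥ g (z i) = 0}

/-- The set of tuples of vectors having a common nonzero annihilator in `V` is closed, since the
annihilator may be taken on the compact unit sphere of `V`. -/
lemma isClosed_setOf_exists_dotProduct_eq_zero (V : Submodule ℂ (ι → ℂ)) (N : ℕ) :
    IsClosed {u : Fin N → ι → ℂ | ∃ c ∈ V, c ≠ 0 ∧ ∀ i, c ⬝ᵥ u i = 0} := by
  have hT : IsClosed {cu : Metric.sphere (0 : V) 1 × (Fin N → ι → ℂ) |
      ∀ i, (cu.1 : V).1 ⬝ᵥ cu.2 i = 0} := by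
    simp only [ofPred_forall, dotProduct]
    refine isClosed_iInter fun i => isClosed_eq (continuous_finsetSum _ fun j _ => ?_)
      continuous_const
    exact ((continuous_apply j).comp (continuous_subtype_val.comp
      (continuous_subtype_val.comp continuous_fst))).mul (by fun_prop)
  convert isClosedMap_snd_of_compactSpace _ hT using 1
  ext u
  constructor
  · rintro ⟨c, hc, hc0, h⟩
    have hn : ‖(⟨c, hc⟩ : V)‖ ≠ 0 := by simpa using hc0
    refine ⟨(⟨((‖(⟨c, hc⟩ : V)‖⁻¹ : ℝ) : ℂ) • ⟨c, hc⟩, ?_⟩, u), fun i => ?_, rfl⟩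
    · rw [mem_sphere_zero_iff_norm, norm_smul, Complex.norm_real, norm_inv, norm_norm,
        inv_mul_cancel₀ hn]
    · simp [smul_dotProduct, h i]
  · rintro ⟨⟨⟨⟨c, hc⟩, hs⟩, u'⟩, h, rfl⟩
    refine ⟨c, hc, ?_, h⟩
    rintro rfl
    rw [mem_sphere_zero_iff_norm, show (⟨0, hc⟩ : V) = 0 from rfl, norm_zero] at hs
    exact zero_ne_one hs

variable [MeasurableSpace Z]

lemma measurableSet_commonKernelSet {g : Z → ι → ℂ} (hg : Measurable g)
    (V : Submodule ℂ (ι → ℂ)) (N : ℕ) : MeasurableSet (commonKernelSet g V N) :=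
  (isClosed_setOf_exists_dotProduct_eq_zero V N).measurableSet.preimage
    (f := fun (z : Fin N → Z) i => g (z i)) (by fun_prop)

/-- If every nonzero combination of the `gₐ` is nonzero with probability at least `x` at a random
point, then `N` independent points fail to determine the coefficients in `V` with probability at
most `2 ^ dim V (1 - x / 2) ^ N`. Indeed, as long as the coefficients in `V` annihilating the points
drawn so far form a nonzero space, the next point lowers its dimension with probability at least
`x`, hence multiplies the expectation of `2 ^ dim` by at most `1 - x / 2`. -/
lemma measure_commonKernelSet_le (π : Measure Z) [IsProbabilityMeasure π] {g : Z → ι → ℂ}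
    (hg : Measurable g) {x : ℝ} (hx₀ : 0 ≤ x) (hx₁ : x ≤ 1)
    (hx : ∀ c : ι → ℂ, c ≠ 0 → ENNReal.ofReal x ≤ π {z | c ⬝ᵥ g z ≠ 0})
    (N : ℕ) (V : Submodule ℂ (ι → ℂ)) :
    Measure.pi (fun _ : Fin N => π) (commonKernelSet g V N) ≤
      ENNReal.ofReal (2 ^ Module.finrank ℂ V * (1 - x / 2) ^ N) := by
  have hx2 : 0 ≤ 1 - x / 2 := by linarith
  induction N generalizing V with
  | zero =>
    refine prob_le_one.trans ?_
    rw [← ENNReal.ofReal_one]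
    apply ENNReal.ofReal_le_ofReal
    simpa using one_le_pow₀ (one_le_two (α := ℝ))
  | succ N ih =>
    rcases eq_or_ne V ⊥ with rfl | hV
    · have : commonKernelSet g (⊥ : Submodule ℂ (ι → ℂ)) (N + 1) = ∅ := by
        refine eq_empty_of_forall_notMem ?_
        rintro z ⟨c, hc, hc0, -⟩
        exact hc0 ((Submodule.mem_bot ℂ).1 hc)
      simp [this]
    obtain ⟨c₀, hc₀V, hc₀⟩ := Submodule.exists_mem_ne_zero_of_ne_bot hV
    have hDpos : 0 < Module.finrank ℂ V := by
      have := (Submodule.one_le_finrank_iff (S := V)).2 hV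
      omega
    obtain ⟨k, hk⟩ : ∃ k, Module.finrank ℂ V = k + 1 := ⟨_, (Nat.succ_pred_eq_of_pos hDpos).symm⟩
    set b : ℝ := 2 ^ k * (1 - x / 2) ^ N with hb
    have hb0 : 0 ≤ b := by positivity
    -- the coefficients in `V` that annihilate the first point
    let V' : Z → Submodule ℂ (ι → ℂ) := fun z =>
      { carrier := {c | c ∈ V ∧ c ⬝ᵥ g z = 0}
        add_mem' := fun h h' => ⟨V.add_mem h.1 h'.1, by simp [add_dotProduct, h.2, h'.2]⟩
        zero_mem' := ⟨V.zero_mem, by simp⟩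
        smul_mem' := fun a c h => ⟨V.smul_mem a h.1, by simp [smul_dotProduct, h.2]⟩ }
    have hV'le : ∀ z, V' z ≤ V := fun z c h => h.1
    let A : Set Z := {z | c₀ ⬝ᵥ g z ≠ 0}
    have hA : MeasurableSet A := by
      have : Measurable fun z => c₀ ⬝ᵥ g z := by
        simp only [dotProduct]
        fun_prop
      exact (measurableSet_singleton (0 : ℂ)).compl.preimage this
    have hAc : π Aᶜ ≤ ENNReal.ofReal (1 - x) := by
      rw [prob_compl_eq_one_sub hA, ENNReal.ofReal_sub _ hx₀, ENNReal.ofReal_one]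
      exact tsub_le_tsub_left (hx c₀ hc₀) _
    have hslice : ∀ z₀ : Z,
        Measure.pi (fun _ : Fin N => π) (commonKernelSet g (V' z₀) N) ≤
          ENNReal.ofReal b + Aᶜ.indicator (fun _ => ENNReal.ofReal b) z₀ := by
      intro z₀
      refine (ih (V' z₀)).trans ?_
      by_cases hz : z₀ ∈ A
      · have hlt : V' z₀ < V := lt_of_le_of_ne (hV'le z₀) fun h =>
          hz ((h ▸ hc₀V : c₀ ∈ V' z₀).2)
        have := Submodule.finrank_lt_finrank_of_lt hlt
        refine le_add_right (ENNReal.ofReal_le_ofReal ?_)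
        rw [hb]
        gcongr
        · norm_num
        · omega
      · have := Submodule.finrank_mono (hV'le z₀)
        rw [indicator_of_mem (show z₀ ∈ Aᶜ from hz), ← ENNReal.ofReal_add hb0 hb0]
        refine ENNReal.ofReal_le_ofReal ?_
        calc (2 : ℝ) ^ Module.finrank ℂ (V' z₀) * (1 - x / 2) ^ N
            ≤ 2 ^ (k + 1) * (1 - x / 2) ^ N := by
              gcongr
              · norm_num
              · omega
          _ = b + b := by rw [hb]; ring
    have he := (measurePreserving_piFinSuccAbove (fun _ : Fin (N + 1) => π) 0).symm
    rw [← he.measure_preimage (measurableSet_commonKernelSet hg V _).nullMeasurableSet,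
      Measure.prod_apply (he.measurable (measurableSet_commonKernelSet hg V _))]
    have hsl : ∀ z₀ : Z, Prod.mk z₀ ⁻¹' ((MeasurableEquiv.piFinSuccAbove
        (fun _ : Fin (N + 1) => Z) 0).symm ⁻¹' commonKernelSet g V (N + 1)) =
        commonKernelSet g (V' z₀) N := by
      intro z₀
      ext z
      simp only [commonKernelSet, mem_preimage, mem_ofPred_eq, Fin.forall_fin_succ,
        MeasurableEquiv.piFinSuccAbove_symm_apply, Fin.insertNthEquiv_zero, Fin.consEquiv_apply,
        Fin.cons_zero, Fin.cons_succ]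
      constructor
      · rintro ⟨c, h1, h2, h3, h4⟩
        exact ⟨c, ⟨h1, h3⟩, h2, h4⟩
      · rintro ⟨c, ⟨h1, h3⟩, h2, h4⟩
        exact ⟨c, h1, h2, h3, h4⟩
    calc _ = ∫⁻ z₀, Measure.pi (fun _ : Fin N => π) (commonKernelSet g (V' z₀) N) ∂π :=
          lintegral_congr fun z₀ => by rw [← hsl]
      _ ≤ ∫⁻ z₀, (ENNReal.ofReal b + Aᶜ.indicator (fun _ => ENNReal.ofReal b) z₀) ∂π :=
          lintegral_mono hslice
      _ = ENNReal.ofReal b + ENNReal.ofReal b * π Aᶜ := by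
          rw [lintegral_add_left measurable_const, lintegral_indicator_const hA.compl]
          simp
      _ ≤ ENNReal.ofReal b + ENNReal.ofReal b * ENNReal.ofReal (1 - x) := by gcongr
      _ = ENNReal.ofReal (2 ^ Module.finrank ℂ V * (1 - x / 2) ^ (N + 1)) := by
          rw [← ENNReal.ofReal_mul hb0, ← ENNReal.ofReal_add hb0
            (mul_nonneg hb0 (by linarith)), hk, hb]
          congr 1
          ring

end Kernel

/-! ### The size of the set where a function of large mixed norm does not vanish -/

/-- Jensen's inequality on a finite measure space, for powers of an `[0, ∞]`-valued function. -/
lemma lintegral_rpow_le {α : Type*} [MeasurableSpace α] (ν : Measure α) {q : ℝ}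
    (hq : 1 < q) {h : α → ℝ≥0∞} (hh : AEMeasurable h ν) :
    (∫⁻ a, h a ∂ν) ^ q ≤ ν univ ^ (q - 1) * ∫⁻ a, h a ^ q ∂ν := by
  have hq0 : 0 < q := by linarith
  have hc : q.HolderConjugate (q / (q - 1)) := Real.HolderConjugate.conjExponent hq
  have := ENNReal.lintegral_mul_le_Lp_mul_Lq ν hc hh (aemeasurable_const (b := (1 : ℝ≥0∞)))
  simp only [Pi.mul_apply, mul_one, ENNReal.one_rpow, lintegral_const, one_mul] at this
  calc (∫⁻ a, h a ∂ν) ^ q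
      ≤ ((∫⁻ a, h a ^ q ∂ν) ^ (1 / q) * ν univ ^ (1 / (q / (q - 1)))) ^ q := by gcongr
    _ = ν univ ^ (q - 1) * ∫⁻ a, h a ^ q ∂ν := by
        rw [ENNReal.mul_rpow_of_nonneg _ _ hq0.le, ← ENNReal.rpow_mul, ← ENNReal.rpow_mul,
          one_div_mul_cancel hq0.ne', ENNReal.rpow_one, mul_comm]
        congr 2
        field_simp

section Norm

variable {G₁ G₂ : Type*} [MeasurableSpace G₁] [MeasurableSpace G₂]

/-- A function bounded by `S` on a rectangle has a mixed norm controlled by the measure of the set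
where it does not vanish. -/
lemma mixedNorm_rpow_le (μ₁ : Measure G₁) (μ₂ : Measure G₂) {p q : ℝ} (hp : 1 < p) (hq : 1 < q)
    {K₁ : Set G₁} {K₂ : Set G₂} (hK₁ : MeasurableSet K₁) (hK₂ : MeasurableSet K₂)
    [SFinite (μ₂.restrict K₂)] {F : G₁ × G₂ → ℂ} (hF : Measurable F)
    {S : ℝ≥0∞} (hS : ∀ z ∈ K₁ ×ˢ K₂, ‖F z‖ₑ ≤ S) :
    mixedNorm μ₁ μ₂ p q K₁ K₂ F ^ (p * q) ≤
      S ^ (p * q) * (μ₁ K₁ ^ (q - 1) * (μ₂ K₂ ^ (p - 1) *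
        ((μ₁.restrict K₁).prod (μ₂.restrict K₂)) {z | F z ≠ 0})) := by
  have hp0 : 0 < p := by linarith
  have hq0 : 0 < q := by linarith
  set ν₁ := μ₁.restrict K₁ with hν₁
  set ν₂ := μ₂.restrict K₂ with hν₂
  have hA : MeasurableSet {z | F z ≠ 0} := (measurableSet_singleton (0 : ℂ)).compl.preimage hF
  set a : G₁ → ℝ≥0∞ := fun u => ν₂ (Prod.mk u ⁻¹' {z | F z ≠ 0}) with ha
  have ham : Measurable a := measurable_measure_prodMk_left hA
  have haK : ∀ u, a u ≤ μ₂ K₂ := fun u => by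
    calc a u ≤ ν₂ univ := measure_mono (subset_univ _)
      _ = μ₂ K₂ := by rw [hν₂, Measure.restrict_apply_univ]
  have hinner : ∀ u ∈ K₁, ∫⁻ v in K₂, ‖F (u, v)‖ₑ ^ q ∂μ₂ ≤ S ^ q * a u := by
    intro u hu
    calc ∫⁻ v in K₂, ‖F (u, v)‖ₑ ^ q ∂μ₂
        ≤ ∫⁻ v in K₂, (Prod.mk u ⁻¹' {z | F z ≠ 0}).indicator (fun _ => S ^ q) v ∂μ₂ := by
          refine setLIntegral_mono' hK₂ fun v hv => ?_
          by_cases h : F (u, v) = 0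
          · simp [h, hq0]
          · rw [indicator_of_mem (show v ∈ Prod.mk u ⁻¹' {z | F z ≠ 0} from h)]
            exact ENNReal.rpow_le_rpow (hS _ ⟨hu, hv⟩) hq0.le
      _ = S ^ q * a u := lintegral_indicator_const (measurable_prodMk_left hA) _
  have houter : ∫⁻ u in K₁, (∫⁻ v in K₂, ‖F (u, v)‖ₑ ^ q ∂μ₂) ^ (p / q) ∂μ₁ ≤
      S ^ p * ∫⁻ u, a u ^ (p / q) ∂ν₁ := by
    rw [← lintegral_const_mul _ (ham.pow_const _)]
    refine setLIntegral_mono' hK₁ fun u hu => ?_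
    calc (∫⁻ v in K₂, ‖F (u, v)‖ₑ ^ q ∂μ₂) ^ (p / q)
        ≤ (S ^ q * a u) ^ (p / q) := by gcongr; exact hinner u hu
      _ = S ^ p * a u ^ (p / q) := by
          rw [ENNReal.mul_rpow_of_nonneg _ _ (by positivity), ← ENNReal.rpow_mul,
            mul_div_cancel₀ _ hq0.ne']
  have hint : ∫⁻ u, a u ^ p ∂ν₁ ≤ μ₂ K₂ ^ (p - 1) * ∫⁻ u, a u ∂ν₁ := by
    rw [← lintegral_const_mul _ ham]
    refine lintegral_mono fun u => ?_
    calc a u ^ p = a u ^ (p - 1) * a u := by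
          conv_rhs => rw [← ENNReal.rpow_one (a u), ← ENNReal.rpow_mul, one_mul]
          rw [← ENNReal.rpow_add_of_nonneg _ _ (by linarith) zero_le_one, sub_add_cancel]
      _ ≤ μ₂ K₂ ^ (p - 1) * a u := by
          gcongr
          exact haK u
  calc mixedNorm μ₁ μ₂ p q K₁ K₂ F ^ (p * q)
      = (∫⁻ u in K₁, (∫⁻ v in K₂, ‖F (u, v)‖ₑ ^ q ∂μ₂) ^ (p / q) ∂μ₁) ^ q := by
        rw [mixedNorm, ← ENNReal.rpow_mul]
        congr 1
        field_simp
    _ ≤ (S ^ p * ∫⁻ u, a u ^ (p / q) ∂ν₁) ^ q := by gcongr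
    _ = S ^ (p * q) * (∫⁻ u, a u ^ (p / q) ∂ν₁) ^ q := by
        rw [ENNReal.mul_rpow_of_nonneg _ _ hq0.le, ← ENNReal.rpow_mul]
    _ ≤ S ^ (p * q) * (ν₁ univ ^ (q - 1) * ∫⁻ u, (a u ^ (p / q)) ^ q ∂ν₁) := by
        gcongr
        exact lintegral_rpow_le ν₁ hq (ham.pow_const _).aemeasurable
    _ = S ^ (p * q) * (μ₁ K₁ ^ (q - 1) * ∫⁻ u, a u ^ p ∂ν₁) := by
        simp_rw [← ENNReal.rpow_mul, div_mul_cancel₀ _ hq0.ne']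
        rw [hν₁, Measure.restrict_apply_univ]
    _ ≤ S ^ (p * q) * (μ₁ K₁ ^ (q - 1) * (μ₂ K₂ ^ (p - 1) * ∫⁻ u, a u ∂ν₁)) := by gcongr
    _ = _ := by rw [ha, ← Measure.prod_apply hA]

end Norm

/-! ### Comparison of the failure probability with the stated bound -/

/-- The lower bound for the number `N` of samples forces `N x ≥ d / κ ^ 2`, so that
`exp (-3 N x / 8)`, the gain of the exponent `x / 2` over the rate `R ≤ x / 8`, absorbs the factor
`(1 / (4 κ)) ^ d`, which is large when `κ` is small. Here `κ = Ct / a₁`, and `x (κ w)` is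
`thresholdConst`. -/
lemma two_pow_mul_one_sub_pow_le {D d N : ℕ} (hD : D ≤ d) {x κ w R : ℝ} (hx₀ : 0 < x)
    (hx₁ : x ≤ 1) (hκ : 0 < κ) (hw : 0 < w) (hR : R ≤ x / 8)
    (hN : 108 * √2 * Real.log 2 * d * w / (x * (κ * w)) ^ 2 * (162 * w + 2 * (x * (κ * w))) < N) :
    2 ^ D * (1 - x / 2) ^ N ≤ 2 * Real.exp (d * Real.log (8 * κ)) * Real.exp (-(N * R)) := by
  have hs : 1 ≤ √2 := Real.one_le_sqrt.2 one_le_two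
  have hl : 1 / 2 ≤ Real.log 2 := by linarith [Real.log_two_gt_d9]
  have hd0 : (0 : ℝ) ≤ d := d.cast_nonneg
  have hNx : d / κ ^ 2 ≤ N * x := by
    have h1 : (d : ℝ) / (x ^ 2 * κ ^ 2) ≤ N := by
      refine le_trans ?_ hN.le
      calc (d : ℝ) / (x ^ 2 * κ ^ 2) = 1 * (1 / 2) * d * w / (x * (κ * w)) ^ 2 * (2 * w) := by
            field_simp
        _ ≤ 108 * √2 * Real.log 2 * d * w / (x * (κ * w)) ^ 2 *
            (162 * w + 2 * (x * (κ * w))) := by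
            gcongr
            · linarith
            · have : 0 ≤ x * (κ * w) := by positivity
              linarith
    calc (d : ℝ) / κ ^ 2 = d / (x ^ 2 * κ ^ 2) * (x * x) := by field_simp
      _ ≤ d / (x ^ 2 * κ ^ 2) * (x * 1) := by gcongr
      _ ≤ N * x := by rw [mul_one]; gcongr
  -- `log t ≤ t - 1` at `t = 1 / (4 κ) ^ 2`
  have hlog : -Real.log (4 * κ) ≤ 1 / (32 * κ ^ 2) := by
    have h1 := Real.log_le_sub_one_of_pos (x := 1 / (16 * κ ^ 2)) (by positivity)
    have h2 : Real.log (1 / (16 * κ ^ 2)) = -(2 * Real.log (4 * κ)) := by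
      rw [one_div, Real.log_inv, show 16 * κ ^ 2 = (4 * κ) ^ 2 by ring, Real.log_pow]
      norm_num
    have h3 : 1 / (32 * κ ^ 2) = 1 / (16 * κ ^ 2) / 2 := by field_simp; norm_num
    rw [h3]
    linarith
  have hlog8 : Real.log (8 * κ) = Real.log 2 + Real.log (4 * κ) := by
    rw [← Real.log_mul (by norm_num) (by positivity)]
    congr 1
    ring
  have hpow : (1 - x / 2) ^ N ≤ Real.exp (-(N * (x / 2))) := by
    rw [show -((N : ℝ) * (x / 2)) = N * -(x / 2) by ring, Real.exp_nat_mul]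
    gcongr
    · linarith
    · linarith [Real.add_one_le_exp (-(x / 2))]
  have htwo : (2 : ℝ) ^ D ≤ Real.exp (d * Real.log 2) := by
    rw [Real.exp_nat_mul, Real.exp_log two_pos]
    exact pow_le_pow_right₀ one_le_two hD
  calc 2 ^ D * (1 - x / 2) ^ N ≤ Real.exp (d * Real.log 2) * Real.exp (-(N * (x / 2))) :=
        mul_le_mul htwo hpow (pow_nonneg (by linarith) _) (Real.exp_pos _).le
    _ = Real.exp (d * Real.log 2 + -(N * (x / 2))) := (Real.exp_add _ _).symm
    _ ≤ Real.exp (d * Real.log (8 * κ) + -(N * R)) := by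
        apply Real.exp_le_exp.2
        have h1 : (d : ℝ) * -Real.log (4 * κ) ≤ d * (1 / (32 * κ ^ 2)) := by gcongr
        have h2 : (d : ℝ) * (1 / (32 * κ ^ 2)) = d / κ ^ 2 / 32 := by field_simp
        have h3 : (N : ℝ) * R ≤ N * (x / 8) := by gcongr
        have h4 : 0 ≤ (N : ℝ) * x := by positivity
        rw [hlog8]
        linarith
    _ = Real.exp (d * Real.log (8 * κ)) * Real.exp (-(N * R)) := Real.exp_add _ _
    _ ≤ 2 * Real.exp (d * Real.log (8 * κ)) * Real.exp (-(N * R)) := by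
        rw [mul_assoc]
        have : 0 ≤ Real.exp (d * Real.log (8 * κ)) * Real.exp (-(N * R)) := by positivity
        linarith

/-! ### Convolution with the averaging function -/

section Conv

variable {G₁ G₂ : Type*} [AddCommGroup G₁] [TopologicalSpace G₁] [MeasurableSpace G₁]
  [AddCommGroup G₂] [TopologicalSpace G₂] [MeasurableSpace G₂]
  {μ₁ : Measure G₁} {μ₂ : Measure G₂} {w : G₁ × G₂ → ℂ} {W₁ : Set G₁} {W₂ : Set G₂}

lemma mixedNorm_one_one {G₁ G₂ : Type*} [MeasurableSpace G₁] [MeasurableSpace G₂]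
    (μ₁ : Measure G₁) (μ₂ : Measure G₂) (A : Set G₁) (B : Set G₂) (f : G₁ × G₂ → ℂ) :
    mixedNorm μ₁ μ₂ 1 1 A B f = ∫⁻ u in A, ∫⁻ v in B, ‖f (u, v)‖ₑ ∂μ₂ ∂μ₁ := by
  simp [mixedNorm]

namespace IsAveragingFunction

lemma eq_zero (hw : IsAveragingFunction μ₁ μ₂ w W₁ W₂) {ζ : G₁ × G₂} (h : ζ ∉ W₁ ×ˢ W₂) :
    w ζ = 0 := by
  by_contra h0
  exact h (hw.support_subset h0)

lemma mixedNorm_lt_top (hw : IsAveragingFunction μ₁ μ₂ w W₁ W₂) :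
    mixedNorm μ₁ μ₂ 1 1 W₁ W₂ w < ∞ := by
  refine lt_of_le_of_lt ?_ hw.integrable.2
  rw [mixedNorm_one_one, mixedNorm_one_one, Measure.restrict_univ, Measure.restrict_univ]
  exact (setLIntegral_le_lintegral _ _).trans (lintegral_mono fun u => setLIntegral_le_lintegral _ _)

lemma conv_eq_setIntegral (hw : IsAveragingFunction μ₁ μ₂ w W₁ W₂) (f : G₁ × G₂ → ℂ)
    (z : G₁ × G₂) :
    conv μ₁ μ₂ f w z = ∫ u in W₁, ∫ v in W₂, f (z - (u, v)) * w (u, v) ∂μ₂ ∂μ₁ := by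
  have h2 : ∀ u, ∫ v in W₂, f (z - (u, v)) * w (u, v) ∂μ₂ = ∫ v, f (z - (u, v)) * w (u, v) ∂μ₂ :=
    fun u => setIntegral_eq_integral_of_forall_compl_eq_zero fun v hv => by
      rw [hw.eq_zero fun h => hv h.2, mul_zero]
  simp_rw [h2]
  refine (setIntegral_eq_integral_of_forall_compl_eq_zero fun u hu => ?_).symm
  simp [hw.eq_zero fun h : (u, _) ∈ _ => hu h.1]

lemma conv_congr (hw : IsAveragingFunction μ₁ μ₂ w W₁ W₂) {f f' : G₁ × G₂ → ℂ} {z : G₁ × G₂}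
    (h : ∀ ζ ∈ W₁ ×ˢ W₂, f (z - ζ) = f' (z - ζ)) : conv μ₁ μ₂ f w z = conv μ₁ μ₂ f' w z := by
  have : ∀ ζ, f (z - ζ) * w ζ = f' (z - ζ) * w ζ := fun ζ => by
    by_cases hζ : ζ ∈ W₁ ×ˢ W₂
    · rw [h ζ hζ]
    · rw [hw.eq_zero hζ, mul_zero, mul_zero]
  simp_rw [conv, this]

lemma enorm_conv_le (hw : IsAveragingFunction μ₁ μ₂ w W₁ W₂) {f : G₁ × G₂ → ℂ} {z : G₁ × G₂}
    {S : ℝ≥0∞} (hS' : S ≠ ∞) (hS : ∀ ζ ∈ W₁ ×ˢ W₂, ‖f (z - ζ)‖ₑ ≤ S) :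
    ‖conv μ₁ μ₂ f w z‖ₑ ≤ S * mixedNorm μ₁ μ₂ 1 1 W₁ W₂ w := by
  rw [hw.conv_eq_setIntegral, mixedNorm_one_one, ← lintegral_const_mul' _ _ hS']
  refine (enorm_integral_le_lintegral_enorm _).trans (lintegral_mono fun u => ?_)
  rw [← lintegral_const_mul' _ _ hS']
  refine (enorm_integral_le_lintegral_enorm _).trans (lintegral_mono fun v => ?_)
  rw [enorm_mul]
  by_cases hζ : (u, v) ∈ W₁ ×ˢ W₂
  · gcongr
    exact hS _ hζ
  · simp [hw.eq_zero hζ]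

lemma isFiniteMeasure_restrict_fst (hw : IsAveragingFunction μ₁ μ₂ w W₁ W₂)
    [IsFiniteMeasureOnCompacts μ₁] : IsFiniteMeasure (μ₁.restrict W₁) :=
  isFiniteMeasure_restrict.2 hw.compact₁.measure_lt_top.ne

lemma isFiniteMeasure_restrict_snd (hw : IsAveragingFunction μ₁ μ₂ w W₁ W₂)
    [IsFiniteMeasureOnCompacts μ₂] : IsFiniteMeasure (μ₂.restrict W₂) :=
  isFiniteMeasure_restrict.2 hw.compact₂.measure_lt_top.ne

variable [IsFiniteMeasureOnCompacts μ₂]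

/-- On the support of the averaging function both Haar measures are finite, so it is integrable for
the product measure. -/
lemma integrable_prod (hw : IsAveragingFunction μ₁ μ₂ w W₁ W₂) :
    Integrable w ((μ₁.restrict W₁).prod (μ₂.restrict W₂)) := by
  have := hw.isFiniteMeasure_restrict_snd
  refine ⟨hw.integrable.1.aestronglyMeasurable, ?_⟩
  rw [HasFiniteIntegral, lintegral_prod _ hw.integrable.1.enorm.aemeasurable,
    ← mixedNorm_one_one μ₁ μ₂ W₁ W₂ w]
  exact hw.mixedNorm_lt_top

variable [IsTopologicalAddGroup G₁] [BorelSpace G₁] [IsTopologicalAddGroup G₂] [BorelSpace G₂]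

lemma integrable_mul (hw : IsAveragingFunction μ₁ μ₂ w W₁ W₂) {φ : G₁ × G₂ → ℂ}
    (hφ : Continuous φ) (hc : HasCompactSupport φ) (z : G₁ × G₂) :
    Integrable (fun ζ => φ (z - ζ) * w ζ) ((μ₁.restrict W₁).prod (μ₂.restrict W₂)) := by
  obtain ⟨C, hC⟩ := hc.exists_bound_of_continuous hφ
  have hm : Measurable fun ζ => φ (z - ζ) :=
    HasCompactSupport.measurable_of_prod (by fun_prop)
      (hc.comp_homeomorph (Homeomorph.subLeft z))
  exact hw.integrable_prod.bdd_mul hm.aestronglyMeasurable (ae_of_all _ fun ζ => hC (z - ζ))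

variable [IsFiniteMeasureOnCompacts μ₁]

lemma conv_eq_integral_prod (hw : IsAveragingFunction μ₁ μ₂ w W₁ W₂) {φ : G₁ × G₂ → ℂ}
    (hφ : Continuous φ) (hc : HasCompactSupport φ) (z : G₁ × G₂) :
    conv μ₁ μ₂ φ w z = ∫ ζ, φ (z - ζ) * w ζ ∂(μ₁.restrict W₁).prod (μ₂.restrict W₂) := by
  have := hw.isFiniteMeasure_restrict_fst
  have := hw.isFiniteMeasure_restrict_snd
  rw [hw.conv_eq_setIntegral, integral_prod _ (hw.integrable_mul hφ hc z)]

lemma conv_sum (hw : IsAveragingFunction μ₁ μ₂ w W₁ W₂) {ι : Type*} (s : Finset ι)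
    {φ : ι → G₁ × G₂ → ℂ} (hφ : ∀ b, Continuous (φ b)) (hc : ∀ b, HasCompactSupport (φ b))
    (a : ι → ℂ) (y : ι → G₁ × G₂) (z : G₁ × G₂) :
    conv μ₁ μ₂ (fun z => ∑ b ∈ s, a b * φ b (z - y b)) w z =
      ∑ b ∈ s, a b * conv μ₁ μ₂ (φ b) w (z - y b) := by
  have hφ' : ∀ b, Continuous fun z => φ b (z - y b) := fun b => by have := hφ b; fun_prop
  have hc' : ∀ b, HasCompactSupport fun z => φ b (z - y b) :=
    fun b => (hc b).comp_homeomorph (Homeomorph.subRight (y b))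
  have hcs : HasCompactSupport fun z => ∑ b ∈ s, a b * φ b (z - y b) := by
    classical
    induction s using Finset.induction_on with
    | empty => exact HasCompactSupport.intro isCompact_empty fun _ _ => Finset.sum_empty
    | insert b s hb ih =>
      simp only [Finset.sum_insert hb]
      exact ((hc' b).mul_left (f := fun _ => a b)).add ih
  rw [hw.conv_eq_integral_prod (by fun_prop) hcs]
  simp_rw [hw.conv_eq_integral_prod (hφ _) (hc _), Finset.sum_mul, mul_assoc]
  rw [integral_finsetSum _ fun b _ => (hw.integrable_mul (hφ' b) (hc' b) z).const_mul _]
  refine Finset.sum_congr rfl fun b _ => ?_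
  rw [integral_const_mul]
  simp_rw [sub_right_comm _ (y b)]

/-- The topology of the groups need not be first countable, so continuity of the convolution is
derived from uniform convergence on the compact support of `w`, not from dominated convergence. -/
lemma continuous_conv (hw : IsAveragingFunction μ₁ μ₂ w W₁ W₂) {φ : G₁ × G₂ → ℂ}
    (hφ : Continuous φ) (hc : HasCompactSupport φ) : Continuous (conv μ₁ μ₂ φ w) := by
  rw [continuous_iff_continuousAt]
  intro z₀
  rw [ContinuousAt, Metric.tendsto_nhds]
  intro ε hε
  set L := (mixedNorm μ₁ μ₂ 1 1 W₁ W₂ w).toReal with hL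
  have hL0 : 0 ≤ L := ENNReal.toReal_nonneg
  have hδ : 0 < ε / (L + 1) := by positivity
  have hu : ∀ᶠ z in 𝓝 z₀, ∀ ζ ∈ W₁ ×ˢ W₂, dist (φ (z - ζ)) (φ (z₀ - ζ)) < ε / (L + 1) := by
    refine (hw.compact₁.prod hw.compact₂).eventually_forall_of_forall_eventually
      (P := fun z ζ => dist (φ (z - ζ)) (φ (z₀ - ζ)) < ε / (L + 1)) fun ζ _ => ?_
    have hct : Continuous fun zζ : (G₁ × G₂) × (G₁ × G₂) =>
      dist (φ (zζ.1 - zζ.2)) (φ (z₀ - zζ.2)) := by fun_prop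
    exact hct.continuousAt.eventually_lt continuousAt_const (by simpa using hδ)
  filter_upwards [hu] with z hz
  have hdiff : conv μ₁ μ₂ φ w z - conv μ₁ μ₂ φ w z₀ =
      conv μ₁ μ₂ (fun ζ => φ (z + ζ) - φ (z₀ + ζ)) w 0 := by
    have hi := hw.integrable_mul hφ hc
    rw [hw.conv_eq_integral_prod hφ hc, hw.conv_eq_integral_prod hφ hc,
      ← integral_sub (hi z) (hi z₀)]
    have hf : Continuous fun ζ => φ (z + ζ) - φ (z₀ + ζ) := by fun_prop
    have hcf : HasCompactSupport fun ζ => φ (z + ζ) - φ (z₀ + ζ) :=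
      (hc.comp_homeomorph (Homeomorph.addLeft z)).sub (hc.comp_homeomorph (Homeomorph.addLeft z₀))
    rw [hw.conv_eq_integral_prod hf hcf]
    simp_rw [zero_sub, ← sub_eq_add_neg, sub_mul]
  have hle := hw.enorm_conv_le (f := fun ζ => φ (z + ζ) - φ (z₀ + ζ)) (z := 0)
    (S := ENNReal.ofReal (ε / (L + 1))) ENNReal.ofReal_ne_top fun ζ hζ => by
      rw [zero_sub, ← sub_eq_add_neg, ← sub_eq_add_neg, ← ofReal_norm, ← dist_eq_norm]
      exact ENNReal.ofReal_le_ofReal (hz ζ hζ).le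
  rw [← hdiff, ← ofReal_norm, ← ENNReal.ofReal_toReal hw.mixedNorm_lt_top.ne, ← hL,
    ← ENNReal.ofReal_mul hδ.le, ENNReal.ofReal_le_ofReal_iff (by positivity)] at hle
  rw [dist_eq_norm]
  calc _ ≤ ε / (L + 1) * L := hle
    _ < ε / (L + 1) * (L + 1) := by gcongr; linarith
    _ = ε := by field_simp

lemma measurable_conv (hw : IsAveragingFunction μ₁ μ₂ w W₁ W₂) {φ : G₁ × G₂ → ℂ}
    (hφ : Continuous φ) (hc : HasCompactSupport φ) : Measurable (conv μ₁ μ₂ φ w) := by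
  refine HasCompactSupport.measurable_of_prod (hw.continuous_conv hφ hc) ?_
  refine HasCompactSupport.intro (K := tsupport φ + W₁ ×ˢ W₂)
    (IsCompact.add hc (hw.compact₁.prod hw.compact₂)) fun z hz => ?_
  rw [hw.conv_congr (f' := 0) fun ζ hζ => ?_]
  · simp [conv]
  · refine image_eq_zero_of_notMem_tsupport fun h => hz ?_
    exact ⟨z - ζ, h, ζ, hζ, sub_add_cancel z ζ⟩

end IsAveragingFunction

end Conv

/-! ### Finitely many active shifts -/

section Active

variable {I G₁ G₂ : Type*} [AddCommGroup G₁] [AddCommGroup G₂] {r : ℕ}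

lemma IsSeparatedFamily.finite_preimage {G : Type*} [AddCommGroup G] [TopologicalSpace G]
    [IsTopologicalAddGroup G] {x : I → G} (hx : IsSeparatedFamily x) {C : Set G}
    (hC : IsCompact C) : (x ⁻¹' C).Finite := by
  obtain ⟨U, hU, hdisj⟩ := hx
  obtain ⟨V, hV, hVU⟩ := exists_nhds_half_neg hU
  obtain ⟨t, -, ht⟩ := hC.elim_nhds_subcover (fun g => (fun z => z - g) ⁻¹' V) fun g _ => by
    have : Filter.Tendsto (fun z : G => z - g) (𝓝 g) (𝓝 0) := by
      simpa using (continuous_id.sub continuous_const).tendsto (f := fun z : G => z - g) g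
    exact this hV
  refine (t.finite_toSet.biUnion fun g _ => ?_).subset
    (preimage_mono ht |>.trans (by rw [preimage_iUnion₂]; exact subset_rfl))
  refine Set.Subsingleton.finite fun i hi j hj => ?_
  by_contra hij
  refine disjoint_left.1 (hdisj hij) ⟨0, mem_of_mem_nhds hU, add_zero _⟩ ⟨x i - x j, ?_, ?_⟩
  · simpa using hVU _ hi _ hj
  · simp

lemma finite_activeSet [TopologicalSpace G₁] [IsTopologicalAddGroup G₁]
    [TopologicalSpace G₂] [IsTopologicalAddGroup G₂] {x : I → G₁} {y : I → G₂}
    (hx : IsSeparatedFamily x) (hy : IsSeparatedFamily y) {Φ : Fin r → G₁ × G₂ → ℂ}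
    (hc : ∀ i, HasCompactSupport (Φ i)) {D : Set (G₁ × G₂)} (hD : IsCompact D) :
    (activeSet Φ x y D).Finite := by
  have hC : IsCompact (D - ⋃ i, tsupport (Φ i)) := by
    rw [sub_eq_add_neg]
    exact hD.add (isCompact_iUnion hc).neg
  refine ((hx.finite_preimage (hC.image continuous_fst)).prod
    (hy.finite_preimage (hC.image continuous_snd))).subset ?_
  rintro ⟨s, t⟩ ⟨z, hz, i, hi⟩
  have hmem : (x s, y t) ∈ D - ⋃ i, tsupport (Φ i) :=
    ⟨z, hz, z - (x s, y t), mem_iUnion.2 ⟨i, subset_tsupport _ hi⟩, sub_sub_cancel _ _⟩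
  exact ⟨⟨_, hmem, rfl⟩, ⟨_, hmem, rfl⟩⟩

lemma mem_activeFinset {Φ : Fin r → G₁ × G₂ → ℂ} {x : I → G₁} {y : I → G₂} {D : Set (G₁ × G₂)}
    (h : (activeSet Φ x y D).Finite) {st : I × I} :
    st ∈ activeFinset Φ x y D ↔ st ∈ activeSet Φ x y D := by
  simp [activeFinset, h]

open Classical in
/-- The coefficients indexed by a finite set `J` of pairs, extended by zero to all pairs. -/
noncomputable def extendCoeff {J : Finset (I × I)} (a : J × Fin r → ℂ) : Fin r → I → I → ℂ :=
  fun i s t => if h : (s, t) ∈ J then a (⟨(s, t), h⟩, i) else 0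

lemma extendCoeff_apply {J : Finset (I × I)} (a : J × Fin r → ℂ) (b : J × Fin r) :
    extendCoeff a b.2 b.1.1.1 b.1.1.2 = a b := by
  simp [extendCoeff]

lemma extendCoeff_of_notMem {J : Finset (I × I)} (a : J × Fin r → ℂ) {s t : I}
    (h : (s, t) ∉ J) (i : Fin r) : extendCoeff a i s t = 0 := by
  simp [extendCoeff, h]

lemma shiftSum_extendCoeff {J : Finset (I × I)} (a : J × Fin r → ℂ) (Ψ : Fin r → G₁ × G₂ → ℂ)
    (x : I → G₁) (y : I → G₂) (z : G₁ × G₂) :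
    shiftSum Ψ x y (extendCoeff a) z =
      ∑ b : J × Fin r, a b * Ψ b.2 (z - (x b.1.1.1, y b.1.1.2)) := by
  rw [shiftSum, tsum_eq_sum (s := J) fun st hst => by simp [extendCoeff_of_notMem a hst],
    Fintype.sum_prod_type, ← Finset.sum_coe_sort]
  simp_rw [← extendCoeff_apply a]

lemma enorm_le_vecSeqNorm {p q : ℝ} (hp : 0 < p) (hq : 0 < q) (c : Fin r → I → I → ℂ)
    (i : Fin r) (s t : I) : ‖c i s t‖ₑ ≤ vecSeqNorm p q c := by
  refine le_trans ?_ (Finset.single_le_sum (f := fun i => seqNorm p q (c i))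
    (fun _ _ => zero_le) (Finset.mem_univ i))
  calc ‖c i s t‖ₑ = ((‖c i s t‖ₑ ^ q) ^ (p / q)) ^ (1 / p) := by
        rw [← ENNReal.rpow_mul, ← ENNReal.rpow_mul,
          show q * (p / q * (1 / p)) = 1 by field_simp, ENNReal.rpow_one]
    _ ≤ seqNorm p q (c i) := by
        refine ENNReal.rpow_le_rpow (le_trans ?_ (ENNReal.le_tsum s)) (by positivity)
        exact ENNReal.rpow_le_rpow (ENNReal.le_tsum (f := fun t => ‖c i s t‖ₑ ^ q) t)
          (by positivity)

lemma vecSeqNorm_extendCoeff_lt_top {p q : ℝ} (hp : 0 < p) (hq : 0 < q) {J : Finset (I × I)}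
    (a : J × Fin r → ℂ) : vecSeqNorm p q (extendCoeff a) < ∞ := by
  classical
  refine ENNReal.sum_lt_top.2 fun i _ => ENNReal.rpow_lt_top_of_nonneg (by positivity) ?_
  have ht : ∀ s t, t ∉ J.image Prod.snd → extendCoeff a i s t = 0 := fun s t h =>
    extendCoeff_of_notMem a (fun h' => h (Finset.mem_image_of_mem Prod.snd h')) i
  have hs : ∀ s, s ∉ J.image Prod.fst → ∀ t, extendCoeff a i s t = 0 := fun s h t =>
    extendCoeff_of_notMem a (fun h' => h (Finset.mem_image_of_mem Prod.fst h')) i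
  rw [tsum_eq_sum (s := J.image Prod.fst) fun s h => by
    simp [hs s h, ENNReal.zero_rpow_of_pos hq, ENNReal.zero_rpow_of_pos (div_pos hp hq)]]
  refine (ENNReal.sum_lt_top.2 fun s _ =>
    ENNReal.rpow_lt_top_of_nonneg (by positivity) ?_).ne
  rw [tsum_eq_sum (s := J.image Prod.snd) fun t h => by
    simp [ht s t h, ENNReal.zero_rpow_of_pos hq]]
  exact (ENNReal.sum_lt_top.2 fun t _ =>
    ENNReal.rpow_lt_top_of_nonneg hq.le enorm_ne_top).ne

lemma extendCoeff_mem_coeffSpace {p q : ℝ} (hp : 0 < p) (hq : 0 < q)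
    {Φ : Fin r → G₁ × G₂ → ℂ} {x : I → G₁} {y : I → G₂} {D : Set (G₁ × G₂)}
    (h : (activeSet Φ x y D).Finite) (a : activeFinset Φ x y D × Fin r → ℂ) :
    extendCoeff a ∈ coeffSpace p q Φ x y D :=
  ⟨vecSeqNorm_extendCoeff_lt_top hp hq a, fun _ _ hst =>
    extendCoeff_of_notMem a (mt (mem_activeFinset h).1 hst)⟩

lemma vecSeqNorm_extendCoeff_ne_zero {p q : ℝ} (hp : 0 < p) (hq : 0 < q) {J : Finset (I × I)}
    {a : J × Fin r → ℂ} (ha : a ≠ 0) : vecSeqNorm p q (extendCoeff a) ≠ 0 := by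
  contrapose! ha
  ext b
  have := enorm_le_vecSeqNorm hp hq (extendCoeff a) b.2 b.1.1.1 b.1.1.2
  rw [ha, extendCoeff_apply] at this
  simpa using this

/-- On `D` the inactive shifts vanish, so only the active coefficients matter there. -/
lemma shiftSum_eq_shiftSum_extendCoeff {Φ : Fin r → G₁ × G₂ → ℂ} {x : I → G₁} {y : I → G₂}
    {D : Set (G₁ × G₂)} (h : (activeSet Φ x y D).Finite) (c : Fin r → I → I → ℂ)
    {z : G₁ × G₂} (hz : z ∈ D) :
    shiftSum Φ x y c z = shiftSum Φ x y
      (extendCoeff fun b : activeFinset Φ x y D × Fin r => c b.2 b.1.1.1 b.1.1.2) z := by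
  refine tsum_congr fun st => Finset.sum_congr rfl fun i _ => ?_
  by_cases hst : (st.1, st.2) ∈ activeFinset Φ x y D
  · simp [extendCoeff, hst]
  · have : Φ i (z - (x st.1, y st.2)) = 0 := by
      by_contra h0
      exact hst ((mem_activeFinset h).2 ⟨z, hz, i, h0⟩)
    rw [this, mul_zero, mul_zero]

variable [TopologicalSpace G₁] [TopologicalSpace G₂]

lemma sum_norm_le_shiftSup {Φ : Fin r → G₁ × G₂ → ℂ} (hΦ : ∀ i, Continuous (Φ i))
    (hc : ∀ i, HasCompactSupport (Φ i)) {x : I → G₁} {y : I → G₂} {D : Set (G₁ × G₂)}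
    (h : (activeSet Φ x y D).Finite) {z : G₁ × G₂} (hz : z ∈ D) :
    ∑ b : activeFinset Φ x y D × Fin r, ‖Φ b.2 (z - (x b.1.1.1, y b.1.1.2))‖ ≤
      shiftSup Φ x y D := by
  have key : ∀ z : D, ∑ i, ∑' st : I × I, ‖Φ i (z.1 - (x st.1, y st.2))‖ =
      ∑ b : activeFinset Φ x y D × Fin r, ‖Φ b.2 (z.1 - (x b.1.1.1, y b.1.1.2))‖ := by
    intro z
    rw [Fintype.sum_prod_type_right]
    refine Finset.sum_congr rfl fun i _ => ?_
    rw [tsum_eq_sum (s := activeFinset Φ x y D) fun st hst => ?_, ← Finset.sum_coe_sort]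
    by_contra h0
    exact hst ((mem_activeFinset h).2 ⟨z, z.2, i, by simpa using h0⟩)
  choose C hC using fun i => (hc i).exists_bound_of_continuous (hΦ i)
  rw [← key ⟨z, hz⟩, shiftSup]
  refine le_ciSup (f := fun z : D => ∑ i, ∑' st : I × I, ‖Φ i (z.1 - (x st.1, y st.2))‖)
    ⟨∑ b : activeFinset Φ x y D × Fin r, C b.2, ?_⟩ ⟨z, hz⟩
  rintro _ ⟨z, rfl⟩
  simp only [key z]
  exact Finset.sum_le_sum fun b _ => hC _ _

lemma enorm_shiftSum_extendCoeff_le {p q : ℝ} (hp : 0 < p) (hq : 0 < q)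
    {Φ : Fin r → G₁ × G₂ → ℂ} (hΦ : ∀ i, Continuous (Φ i))
    (hc : ∀ i, HasCompactSupport (Φ i)) {x : I → G₁} {y : I → G₂} {D : Set (G₁ × G₂)}
    (h : (activeSet Φ x y D).Finite) (a : activeFinset Φ x y D × Fin r → ℂ)
    {z : G₁ × G₂} (hz : z ∈ D) :
    ‖shiftSum Φ x y (extendCoeff a) z‖ₑ ≤
      ENNReal.ofReal (shiftSup Φ x y D) * vecSeqNorm p q (extendCoeff a) := by
  rw [shiftSum_extendCoeff]
  calc _ ≤ ∑ b : activeFinset Φ x y D × Fin r,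
          ‖a b * Φ b.2 (z - (x b.1.1.1, y b.1.1.2))‖ₑ := enorm_sum_le _ _
    _ ≤ ∑ b : activeFinset Φ x y D × Fin r, ‖Φ b.2 (z - (x b.1.1.1, y b.1.1.2))‖ₑ *
          vecSeqNorm p q (extendCoeff a) := by
        refine Finset.sum_le_sum fun b _ => ?_
        rw [enorm_mul, mul_comm]
        gcongr
        rw [← extendCoeff_apply a b]
        exact enorm_le_vecSeqNorm hp hq _ _ _ _
    _ ≤ ENNReal.ofReal (shiftSup Φ x y D) * vecSeqNorm p q (extendCoeff a) := by
        rw [← Finset.sum_mul]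
        gcongr
        simp_rw [← ofReal_norm]
        rw [← ENNReal.ofReal_sum_of_nonneg fun _ _ => norm_nonneg _]
        exact ENNReal.ofReal_le_ofReal (sum_norm_le_shiftSup hΦ hc h hz)

end Active

/-! ### The dimension of the local space -/

section Dim

variable {I G₁ G₂ : Type*} [AddCommGroup G₁] [TopologicalSpace G₁] [MeasurableSpace G₁]
  [AddCommGroup G₂] [TopologicalSpace G₂] [MeasurableSpace G₂] {r : ℕ}
  {μ₁ : Measure G₁} {μ₂ : Measure G₂} {p q : ℝ} {Φ : Fin r → G₁ × G₂ → ℂ} {x : I → G₁}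
  {y : I → G₂} {A : Set G₁} {B : Set G₂} {a₁ a₂ : ℝ}

lemma mixedNorm_indicator {G₁ G₂ : Type*} [MeasurableSpace G₁] [MeasurableSpace G₂]
    (μ₁ : Measure G₁) (μ₂ : Measure G₂) (hp : 0 < p) (hq : 0 < q) {A : Set G₁} {B : Set G₂}
    (hA : MeasurableSet A) (hB : MeasurableSet B) (f : G₁ × G₂ → ℂ) :
    mixedNorm μ₁ μ₂ p q univ univ ((A ×ˢ B).indicator f) = mixedNorm μ₁ μ₂ p q A B f := by
  simp only [mixedNorm, Measure.restrict_univ]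
  rw [← lintegral_indicator hA]
  congr 2
  ext u
  by_cases hu : u ∈ A
  · rw [indicator_of_mem hu, ← lintegral_indicator hB]
    congr 2
    ext v
    by_cases hv : v ∈ B <;> simp [hu, hv, hq]
  · simp [hu, hq, div_pos hp hq]

/-- By stability, a combination of active shifts that vanishes on the domain is trivial. -/
lemma HasStableShifts.eq_zero (hΦ : HasStableShifts μ₁ μ₂ p q Φ x y A B a₁ a₂)
    (hA : MeasurableSet A) (hB : MeasurableSet B) (hp : 0 < p) (hq : 0 < q)
    (h : (activeSet Φ x y (A ×ˢ B)).Finite) {a : activeFinset Φ x y (A ×ˢ B) × Fin r → ℂ}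
    (ha : ∀ z ∈ A ×ˢ B, shiftSum Φ x y (extendCoeff a) z = 0) : a = 0 := by
  by_contra ha0
  have h0 : mixedNorm μ₁ μ₂ p q A B (shiftSum Φ x y (extendCoeff a)) = 0 := by
    rw [← mixedNorm_indicator μ₁ μ₂ hp hq hA hB, indicator_eq_zero'.2]
    · simp [mixedNorm, hp, hq, div_pos hp hq]
    · exact disjoint_left.2 fun z hz hzD => hz (ha z hzD)
  have hl := hΦ.lower _ (extendCoeff_mem_coeffSpace hp hq h a)
  rw [h0, nonpos_iff_eq_zero, mul_eq_zero, ENNReal.ofReal_eq_zero, not_le.2 hΦ.pos |> iff_false_intro,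
    false_or] at hl
  exact vecSeqNorm_extendCoeff_ne_zero hp hq ha0 hl

/-- The real dimension of the local space is at least the number of its coefficients (it is in fact
twice that number, the coefficients being complex). -/
lemma card_le_localDim [IsTopologicalAddGroup G₁] [BorelSpace G₁] [IsTopologicalAddGroup G₂]
    [BorelSpace G₂] (hΦ : HasStableShifts μ₁ μ₂ p q Φ x y A B a₁ a₂)
    (hA : MeasurableSet A) (hB : MeasurableSet B) (hp : 0 < p) (hq : 0 < q)
    (h : (activeSet Φ x y (A ×ˢ B)).Finite) :
    Fintype.card (activeFinset Φ x y (A ×ˢ B) × Fin r) ≤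
      localDim μ₁ μ₂ p q Φ x y (A ×ˢ B) := by
  let T : (activeFinset Φ x y (A ×ˢ B) × Fin r → ℂ) →ₗ[ℝ] (A ×ˢ B : Set (G₁ × G₂)) → ℂ :=
    { toFun := fun a z => shiftSum Φ x y (extendCoeff a) z
      map_add' := fun a b => by
        ext z
        simp [shiftSum_extendCoeff, add_mul, Finset.sum_add_distrib]
      map_smul' := fun k a => by
        ext z
        simp [shiftSum_extendCoeff, Finset.mul_sum, mul_assoc] }
  have hT : Function.Injective T := by
    rw [injective_iff_map_eq_zero]
    exact fun a ha => hΦ.eq_zero hA hB hp hq h fun z hz => congrFun ha ⟨z, hz⟩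
  have himage : (fun f : G₁ × G₂ → ℂ => (A ×ˢ B).domRestrict f) ''
      localSpace μ₁ μ₂ p q Φ x y (A ×ˢ B) = LinearMap.range T := by
    ext F
    constructor
    · rintro ⟨f, ⟨-, c, -, hfc⟩, rfl⟩
      refine ⟨fun b => c b.2 b.1.1.1 b.1.1.2, ?_⟩
      ext z
      exact (shiftSum_eq_shiftSum_extendCoeff h c z.2).symm.trans (hfc z z.2).symm
    · rintro ⟨a, rfl⟩
      refine ⟨(A ×ˢ B).indicator (shiftSum Φ x y (extendCoeff a)), ⟨⟨?_, ?_⟩, extendCoeff a,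
        vecSeqNorm_extendCoeff_lt_top hp hq a, fun z hz => indicator_of_mem hz _⟩, ?_⟩
      · refine Measurable.indicator ?_ (hA.prod hB)
        simp only [funext fun z => shiftSum_extendCoeff a Φ x y z]
        refine Finset.measurable_sum _ fun b _ => Measurable.const_mul ?_ _
        have := hΦ.continuous b.2
        exact HasCompactSupport.measurable_of_prod (by fun_prop)
          ((hΦ.compactSupport b.2).comp_homeomorph (Homeomorph.subRight _))
      · rw [mixedNorm_indicator μ₁ μ₂ hp hq hA hB]
        exact (hΦ.upper _ (extendCoeff_mem_coeffSpace hp hq h a)).trans_lt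
          (ENNReal.mul_lt_top ENNReal.ofReal_lt_top (vecSeqNorm_extendCoeff_lt_top hp hq a))
      · ext z
        exact indicator_of_mem z.2 _
  rw [localDim, Set.finrank, himage, Submodule.span_eq, LinearMap.finrank_range_of_inj hT,
    Module.finrank_pi_fintype]
  simp [Complex.finrank_real_complex]
  omega

end Dim

/-! ### Reconstruction from the samples -/

open scoped ComplexOrder in
/-- A matrix with trivial kernel has its least-squares inverse as a left inverse. -/
lemma leastSquaresInverse_mul {κ ι : Type*} [Fintype κ] [Fintype ι] [DecidableEq ι]
    {M : Matrix κ ι ℂ} (hM : ∀ c, M *ᵥ c = 0 → c = 0) : leastSquaresInverse M * M = 1 := by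
  classical
  have hu : IsUnit (Mᴴ * M) := by
    rw [← Matrix.mulVec_injective_iff_isUnit, ← Matrix.coe_mulVecLin, injective_iff_map_eq_zero]
    intro c hc
    exact hM c ((Matrix.conjTranspose_mul_self_mulVec_eq_zero M c).1 hc)
  rw [leastSquaresInverse, Matrix.mul_assoc]
  convert Matrix.nonsing_inv_mul _ ((Matrix.isUnit_iff_isUnit_det _).1 hu)

section Sampling

variable {I G₁ G₂ : Type*} [AddCommGroup G₁] [TopologicalSpace G₁] [IsTopologicalAddGroup G₁]
  [MeasurableSpace G₁] [BorelSpace G₁] [AddCommGroup G₂] [TopologicalSpace G₂]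
  [IsTopologicalAddGroup G₂] [MeasurableSpace G₂] [BorelSpace G₂] {r : ℕ}
  {μ₁ : Measure G₁} {μ₂ : Measure G₂} [IsFiniteMeasureOnCompacts μ₁] [IsFiniteMeasureOnCompacts μ₂]
  {p q : ℝ} {Φ : Fin r → G₁ × G₂ → ℂ} {x : I → G₁}
  {y : I → G₂} {w : G₁ × G₂ → ℂ} {W₁ : Set G₁} {W₂ : Set G₂} {D : Set (G₁ × G₂)}

/-- The averaged sample of a combination of shifts only involves the averaged generators. -/
lemma conv_shiftSum_extendCoeff (hw : IsAveragingFunction μ₁ μ₂ w W₁ W₂)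
    (hΦ : ∀ i, Continuous (Φ i)) (hc : ∀ i, HasCompactSupport (Φ i)) {J : Finset (I × I)}
    (a : J × Fin r → ℂ) (z : G₁ × G₂) :
    conv μ₁ μ₂ (shiftSum Φ x y (extendCoeff a)) w z =
      shiftSum (fun i => conv μ₁ μ₂ (Φ i) w) x y (extendCoeff a) z := by
  rw [shiftSum_extendCoeff, funext fun z => shiftSum_extendCoeff a Φ x y z]
  exact hw.conv_sum _ (fun b : J × Fin r => hΦ b.2) (fun b => hc b.2) _ _ _

/-- If the sampling matrix has trivial kernel, its least-squares inverse recovers the coefficients,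
and hence the function, from the averaged samples. -/
lemma eq_sum_conv_mul_reconFun (hw : IsAveragingFunction μ₁ μ₂ w W₁ W₂)
    (hΦ : ∀ i, Continuous (Φ i)) (hc : ∀ i, HasCompactSupport (Φ i))
    (h : (activeSet Φ x y D).Finite) {n m : ℕ} {z : Fin n → Fin m → G₁ × G₂}
    (hz : ∀ j k, ∀ ζ ∈ W₁ ×ˢ W₂, z j k - ζ ∈ D)
    (hM : ∀ c, samplingMatrix μ₁ μ₂ Φ w x y D z *ᵥ c = 0 → c = 0)
    {f : G₁ × G₂ → ℂ} (hf : f ∈ localSpace μ₁ μ₂ p q Φ x y D) {g : G₁ × G₂} (hg : g ∈ D) :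
    f g = ∑ j, ∑ k, conv μ₁ μ₂ f w (z j k) * reconFun μ₁ μ₂ Φ w x y D z j k g := by
  classical
  obtain ⟨-, c, -, hfc⟩ := hf
  set a : activeFinset Φ x y D × Fin r → ℂ := fun b => c b.2 b.1.1.1 b.1.1.2 with ha
  set M := samplingMatrix μ₁ μ₂ Φ w x y D z with hMdef
  have hfa : ∀ z ∈ D, f z = shiftSum Φ x y (extendCoeff a) z := fun z hz =>
    (hfc z hz).trans (shiftSum_eq_shiftSum_extendCoeff h c hz)
  have hsample : ∀ j k, conv μ₁ μ₂ f w (z j k) = (M *ᵥ a) (j, k) := by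
    intro j k
    rw [hw.conv_congr fun ζ hζ => hfa _ (hz j k ζ hζ), conv_shiftSum_extendCoeff hw hΦ hc,
      shiftSum_extendCoeff]
    exact Finset.sum_congr rfl fun b _ => mul_comm _ _
  have hrec : leastSquaresInverse M *ᵥ (M *ᵥ a) = a := by
    rw [Matrix.mulVec_mulVec, leastSquaresInverse_mul hM, Matrix.one_mulVec]
  rw [hfa g hg, shiftSum_extendCoeff]
  conv_lhs => rw [← hrec]
  simp only [hsample, reconFun, Finset.mul_sum]
  rw [← Fintype.sum_prod_type' (f := fun j k => ∑ b : activeFinset Φ x y D × Fin r,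
    (M *ᵥ a) (j, k) * (leastSquaresInverse M b (j, k) * Φ b.2 (g - (x b.1.1.1, y b.1.1.2)))),
    Finset.sum_comm]
  refine Finset.sum_congr rfl fun b _ => ?_
  rw [Matrix.mulVec, dotProduct, Finset.sum_mul]
  exact Finset.sum_congr rfl fun jk _ => by ring

end Sampling

/-! ### The law of the sampling points -/

section Law

variable {G₁ G₂ : Type*} [MeasurableSpace G₁] [MeasurableSpace G₂] {μ₁ : Measure G₁}
  {μ₂ : Measure G₂} {K₁ : Set G₁} {K₂ : Set G₂} {ρ : G₁ × G₂ → ℝ} {C₁ C₂ : ℝ}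

lemma prod_restrict_compl [SFinite (μ₁.restrict K₁)] [SFinite (μ₂.restrict K₂)]
    (hK₁ : MeasurableSet K₁) (hK₂ : MeasurableSet K₂) :
    ((μ₁.restrict K₁).prod (μ₂.restrict K₂)) (K₁ ×ˢ K₂)ᶜ = 0 := by
  rw [compl_prod_eq_union]
  refine measure_union_null ?_ ?_
  · rw [Measure.prod_prod, Measure.restrict_apply hK₁.compl]
    simp
  · rw [Measure.prod_prod, Measure.restrict_apply hK₂.compl]
    simp

lemma sampleLaw_compl [SFinite (μ₁.restrict K₁)] [SFinite (μ₂.restrict K₂)]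
    (hK₁ : MeasurableSet K₁) (hK₂ : MeasurableSet K₂) :
    sampleLaw μ₁ μ₂ K₁ K₂ ρ (K₁ ×ˢ K₂)ᶜ = 0 :=
  withDensity_absolutelyContinuous _ _ (prod_restrict_compl hK₁ hK₂)

lemma IsBoundedDensity.le_sampleLaw [SFinite (μ₁.restrict K₁)] [SFinite (μ₂.restrict K₂)]
    (hρ : IsBoundedDensity μ₁ μ₂ K₁ K₂ ρ C₁ C₂) (hK₁ : MeasurableSet K₁) (hK₂ : MeasurableSet K₂)
    {S : Set (G₁ × G₂)} (hS : MeasurableSet S) :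
    ENNReal.ofReal C₁ * ((μ₁.restrict K₁).prod (μ₂.restrict K₂)) S ≤
      sampleLaw μ₁ μ₂ K₁ K₂ ρ S := by
  rw [sampleLaw, withDensity_apply _ hS, ← setLIntegral_const]
  refine lintegral_mono_ae (ae_restrict_of_ae ?_)
  filter_upwards [compl_mem_ae_iff.2 (prod_restrict_compl (μ₁ := μ₁) (μ₂ := μ₂) hK₁ hK₂)] with z hz
  exact ENNReal.ofReal_le_ofReal (hρ.lower z (not_not.1 hz))

end Law

/-! ### The probability that an averaged combination does not vanish at a random point -/

section Nonvanishing

variable {I G₁ G₂ : Type*} [AddCommGroup G₁] [MeasurableSpace G₁] [AddCommGroup G₂]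
  [MeasurableSpace G₂] {r : ℕ}

/-- The averaged shifts at a point, as a vector indexed by the active pairs and the components. -/
noncomputable def averagedShifts (μ₁ : Measure G₁) (μ₂ : Measure G₂) (Φ : Fin r → G₁ × G₂ → ℂ)
    (w : G₁ × G₂ → ℂ) (x : I → G₁) (y : I → G₂) (J : Finset (I × I)) (z : G₁ × G₂)
    (b : J × Fin r) : ℂ :=
  conv μ₁ μ₂ (Φ b.2) w (z - (x b.1.1.1, y b.1.1.2))

lemma shiftSum_conv_eq_dotProduct (μ₁ : Measure G₁) (μ₂ : Measure G₂) (Φ : Fin r → G₁ × G₂ → ℂ)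
    (w : G₁ × G₂ → ℂ) (x : I → G₁) (y : I → G₂) {J : Finset (I × I)} (a : J × Fin r → ℂ) (z : G₁ × G₂) :
    shiftSum (fun i => conv μ₁ μ₂ (Φ i) w) x y (extendCoeff a) z =
      a ⬝ᵥ averagedShifts μ₁ μ₂ Φ w x y J z :=
  shiftSum_extendCoeff _ _ _ _ _

variable [TopologicalSpace G₁] [IsTopologicalAddGroup G₁] [BorelSpace G₁]
  [TopologicalSpace G₂] [IsTopologicalAddGroup G₂] [BorelSpace G₂]
  {μ₁ : Measure G₁} {μ₂ : Measure G₂} [IsFiniteMeasureOnCompacts μ₁]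
  [IsFiniteMeasureOnCompacts μ₂] {p q : ℝ} {Φ : Fin r → G₁ × G₂ → ℂ} {x : I → G₁} {y : I → G₂}
  {w : G₁ × G₂ → ℂ} {W₁ : Set G₁} {W₂ : Set G₂}

lemma measurable_averagedShifts [LocallyCompactSpace G₁] [LocallyCompactSpace G₂]
    (hw : IsAveragingFunction μ₁ μ₂ w W₁ W₂) (hΦ : ∀ i, Continuous (Φ i))
    (hc : ∀ i, HasCompactSupport (Φ i)) (J : Finset (I × I)) :
    Measurable (averagedShifts μ₁ μ₂ Φ w x y J) := by
  refine measurable_pi_iff.2 fun b => (hw.measurable_conv (hΦ b.2) (hc b.2)).comp ?_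
  exact (measurable_fst.sub_const _).prodMk (measurable_snd.sub_const _)

/-- A nonzero averaged combination of active shifts has mixed norm at least `β ‖a‖` over `K₁ × K₂`
and absolute value at most `Ct Nw ‖a‖` there, so the set where it does not vanish is not small. -/
lemma rpow_le_mul_measureReal_ne_zero [LocallyCompactSpace G₁] [LocallyCompactSpace G₂]
    (hp : 1 < p) (hq : 1 < q) (hw : IsAveragingFunction μ₁ μ₂ w W₁ W₂)
    (hΦ : ∀ i, Continuous (Φ i)) (hc : ∀ i, HasCompactSupport (Φ i))
    {K₁ : Set G₁} {K₂ : Set G₂} (hK₁ : MeasurableSet K₁) (hK₂ : MeasurableSet K₂)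
    [IsFiniteMeasure (μ₁.restrict K₁)] [IsFiniteMeasure (μ₂.restrict K₂)]
    {D : Set (G₁ × G₂)} (hD : ∀ z ∈ K₁ ×ˢ K₂, ∀ ζ ∈ W₁ ×ˢ W₂, z - ζ ∈ D)
    (h : (activeSet Φ x y D).Finite) {β : ℝ} (hβ : 0 < β)
    (hlow : ∀ c ∈ coeffSpace p q Φ x y D,
      ENNReal.ofReal β * vecSeqNorm p q c ≤
        mixedNorm μ₁ μ₂ p q K₁ K₂ (shiftSum (fun i => conv μ₁ μ₂ (Φ i) w) x y c))
    {a : activeFinset Φ x y D × Fin r → ℂ} (ha : a ≠ 0) :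
    β ^ (p * q) ≤ (shiftSup Φ x y D *
        (mixedNorm μ₁ μ₂ 1 1 W₁ W₂ w).toReal) ^ (p * q) *
      (μ₁.real K₁ ^ (q - 1) * (μ₂.real K₂ ^ (p - 1) *
        ((μ₁.restrict K₁).prod (μ₂.restrict K₂)).real
          {z | a ⬝ᵥ averagedShifts μ₁ μ₂ Φ w x y _ z ≠ 0})) := by
  have hp0 : 0 < p := by linarith
  have hq0 : 0 < q := by linarith
  have hpq : 0 ≤ p * q := by positivity
  set L := vecSeqNorm p q (extendCoeff a) with hL
  set Ct := shiftSup Φ x y D with hCt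
  set M := mixedNorm μ₁ μ₂ 1 1 W₁ W₂ w with hM
  have hL0 : L ≠ 0 := vecSeqNorm_extendCoeff_ne_zero hp0 hq0 ha
  have hLtop : L ≠ ∞ := (vecSeqNorm_extendCoeff_lt_top hp0 hq0 a).ne
  have hMtop : M ≠ ∞ := hw.mixedNorm_lt_top.ne
  have hCt0 : 0 ≤ Ct := Real.iSup_nonneg fun z =>
    Finset.sum_nonneg fun i _ => tsum_nonneg fun st => norm_nonneg _
  set F : G₁ × G₂ → ℂ := shiftSum (fun i => conv μ₁ μ₂ (Φ i) w) x y (extendCoeff a) with hF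
  have hFdot : ∀ z, F z = a ⬝ᵥ averagedShifts μ₁ μ₂ Φ w x y _ z := shiftSum_conv_eq_dotProduct μ₁ μ₂ Φ w x y a
  have hFm : Measurable F := by
    have hg := measurable_averagedShifts (x := x) (y := y) hw hΦ hc (activeFinset Φ x y D)
    simp only [funext hFdot, dotProduct]
    fun_prop
  have hS : ∀ z ∈ K₁ ×ˢ K₂, ‖F z‖ₑ ≤ ENNReal.ofReal Ct * L * M := by
    intro z hz
    rw [hF, ← conv_shiftSum_extendCoeff hw hΦ hc]
    refine hw.enorm_conv_le (ENNReal.mul_ne_top ENNReal.ofReal_ne_top hLtop) fun ζ hζ => ?_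
    exact enorm_shiftSum_extendCoeff_le hp0 hq0 hΦ hc h a
      (hD z hz ζ hζ)
  have hmain := (ENNReal.rpow_le_rpow (hlow _ (extendCoeff_mem_coeffSpace hp0 hq0 h a)) hpq).trans
    (mixedNorm_rpow_le μ₁ μ₂ hp hq hK₁ hK₂ hFm hS)
  rw [show ENNReal.ofReal Ct * L * M = ENNReal.ofReal Ct * M * L by ring,
    ENNReal.mul_rpow_of_nonneg _ L hpq, ENNReal.mul_rpow_of_nonneg _ L hpq,
    mul_comm _ (L ^ (p * q)), mul_comm _ (L ^ (p * q)), mul_assoc,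
    ENNReal.mul_le_mul_iff_right
      (by simp [hL0, hLtop])
      (ENNReal.rpow_ne_top_of_nonneg hpq hLtop)] at hmain
  have hk₁ : μ₁ K₁ ≠ ∞ := by
    simpa using measure_ne_top (μ₁.restrict K₁) univ
  have hk₂ : μ₂ K₂ ≠ ∞ := by
    simpa using measure_ne_top (μ₂.restrict K₂) univ
  have hreal := ENNReal.toReal_mono (ENNReal.mul_ne_top (ENNReal.rpow_ne_top_of_nonneg hpq
    (ENNReal.mul_ne_top ENNReal.ofReal_ne_top hMtop)) (ENNReal.mul_ne_top
      (ENNReal.rpow_ne_top_of_nonneg (by linarith) hk₁) (ENNReal.mul_ne_top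
        (ENNReal.rpow_ne_top_of_nonneg (by linarith) hk₂) (measure_ne_top _ _)))) hmain
  simp only [ENNReal.toReal_mul, ← ENNReal.toReal_rpow, ENNReal.toReal_ofReal hβ.le,
    ENNReal.toReal_ofReal hCt0, hFdot] at hreal
  exact hreal

end Nonvanishing

/-- Arithmetic behind the lower bound for the probability of not vanishing, where `l` is the measure
of the set of points of the sampling domain at which a combination does not vanish. -/
lemma constants_of_rpow_le {p q m₁ m₂ a₁ a₂ Ct Nw C γ β l : ℝ} (hp : 1 < p) (hq : 1 < q)
    (hm₁ : 0 ≤ m₁) (hm₂ : 0 ≤ m₂) (hCt : 0 ≤ Ct) (hNw : 0 ≤ Nw) (hC : 0 < C) (hγ₀ : 0 < γ)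
    (hγ₁ : γ < 1) (hβ : 0 < β) (ha₁ : 0 < a₁) (ha : a₁ ≤ a₂)
    (h : β ^ (p * q) ≤ (Ct * Nw) ^ (p * q) * (m₁ ^ (q - 1) * (m₂ ^ (p - 1) * l))) :
    0 < m₁ ∧ 0 < m₂ ∧ 0 < Ct ∧ 0 < Nw ∧
      m₁ ^ (1 - q) * m₂ ^ (1 - p) * (γ * C * (a₁ * (β / a₂) / (Ct * Nw)) ^ (p * q)) ≤ C * l := by
  have hpq : 0 < p * q := by nlinarith
  have hpos := (Real.rpow_pos_of_pos hβ (p * q)).trans_le h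
  have hm₁' : 0 < m₁ := hm₁.lt_of_ne fun h0 => by
    simp [← h0, Real.zero_rpow (sub_ne_zero.2 hq.ne')] at hpos
  have hm₂' : 0 < m₂ := hm₂.lt_of_ne fun h0 => by
    simp [← h0, Real.zero_rpow (sub_ne_zero.2 hp.ne')] at hpos
  have hCt' : 0 < Ct := hCt.lt_of_ne fun h0 => by
    simp [← h0, Real.zero_rpow hpq.ne'] at hpos
  have hNw' : 0 < Nw := hNw.lt_of_ne fun h0 => by
    simp [← h0, Real.zero_rpow hpq.ne'] at hpos
  have ha₂ : 0 < a₂ := ha₁.trans_le ha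
  refine ⟨hm₁', hm₂', hCt', hNw', ?_⟩
  have hζ : a₁ * (β / a₂) ≤ β := by
    rw [mul_div_assoc', div_le_iff₀ ha₂, mul_comm]
    gcongr
  have h1 : (a₁ * (β / a₂) / (Ct * Nw)) ^ (p * q) ≤ m₁ ^ (q - 1) * (m₂ ^ (p - 1) * l) := by
    calc (a₁ * (β / a₂) / (Ct * Nw)) ^ (p * q) ≤ (β / (Ct * Nw)) ^ (p * q) := by gcongr
      _ = β ^ (p * q) / (Ct * Nw) ^ (p * q) := Real.div_rpow hβ.le (by positivity) _
      _ ≤ _ := by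
        rw [div_le_iff₀ (by positivity), mul_comm _ ((Ct * Nw) ^ (p * q))]
        exact h
  have e₁ : m₁ ^ (1 - q) = (m₁ ^ (q - 1))⁻¹ := by rw [← Real.rpow_neg hm₁, neg_sub]
  have e₂ : m₂ ^ (1 - p) = (m₂ ^ (p - 1))⁻¹ := by rw [← Real.rpow_neg hm₂, neg_sub]
  calc m₁ ^ (1 - q) * m₂ ^ (1 - p) * (γ * C * (a₁ * (β / a₂) / (Ct * Nw)) ^ (p * q))
      ≤ m₁ ^ (1 - q) * m₂ ^ (1 - p) * (1 * C * (m₁ ^ (q - 1) * (m₂ ^ (p - 1) * l))) := by gcongr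
    _ = C * l := by
      have : 0 < m₁ ^ (q - 1) := by positivity
      have : 0 < m₂ ^ (p - 1) := by positivity
      rw [e₁, e₂]
      field_simp

/-- In terms of the lower bound `X` for the probability that a combination does not vanish at a
random point, `thresholdConst = X (Ct / a₁) Nw`. -/
lemma thresholdConst_eq {p q m₁ m₂ a₁ Ct Nw C γ ζ : ℝ} (ha₁ : 0 < a₁) (hCt : 0 < Ct)
    (hNw : 0 < Nw) (hζ : 0 < ζ) :
    thresholdConst p q m₁ m₂ a₁ Ct Nw C γ ζ =
      m₁ ^ (1 - q) * m₂ ^ (1 - p) * (γ * C * (a₁ * ζ / (Ct * Nw)) ^ (p * q)) *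
        (Ct / a₁ * Nw) := by
  have hA : 0 < Ct / a₁ * Nw := by positivity
  have e : a₁ * ζ / (Ct * Nw) = ζ / (Ct / a₁ * Nw) := by field_simp
  rw [thresholdConst, e, Real.div_rpow hζ.le hA.le, Real.rpow_sub hA, Real.rpow_one]
  ring

lemma rate₁_le {p q m₁ m₂ a₁ Ct Nw C γ ζ : ℝ} (hm₁ : 0 < m₁) (hm₂ : 0 < m₂) (hC : 0 < C)
    (hγ : 0 < γ) (ha₁ : 0 < a₁) (hCt : 0 < Ct) (hNw : 0 < Nw) (hζ : 0 < ζ)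
    (h1 : m₁ ^ (1 - q) * m₂ ^ (1 - p) * (γ * C * (a₁ * ζ / (Ct * Nw)) ^ (p * q)) ≤ 1) :
    rate₁ p q m₁ m₂ a₁ Ct Nw C γ ζ ≤
      m₁ ^ (1 - q) * m₂ ^ (1 - p) * (γ * C * (a₁ * ζ / (Ct * Nw)) ^ (p * q)) / 8 := by
  have e₁ : m₁ ^ (1 - q) = (m₁ ^ (q - 1))⁻¹ := by rw [← Real.rpow_neg hm₁.le, neg_sub]
  have e₂ : m₂ ^ (1 - p) = (m₂ ^ (p - 1))⁻¹ := by rw [← Real.rpow_neg hm₂.le, neg_sub]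
  have hX : 0 < γ * C * (a₁ * ζ / (Ct * Nw)) ^ (p * q) := by positivity
  have ht₁ : 0 < m₁ ^ (q - 1) := by positivity
  have ht₂ : 0 < m₂ ^ (p - 1) := by positivity
  have h3 : √3 ^ 2 = 3 := Real.sq_sqrt (by norm_num)
  rw [rate₁, e₁, e₂, show √3 / 2 * γ * C * (a₁ * ζ / (Ct * Nw)) ^ (p * q) =
    √3 / 2 * (γ * C * (a₁ * ζ / (Ct * Nw)) ^ (p * q)) by ring, mul_pow, div_pow, h3]
  rw [e₁, e₂] at h1
  generalize γ * C * (a₁ * ζ / (Ct * Nw)) ^ (p * q) = X at *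
  rw [show (6 : ℝ) * m₁ ^ (q - 1) * m₂ ^ (p - 1) = 6 * (m₁ ^ (q - 1) * m₂ ^ (p - 1)) by ring,
    ← mul_inv] at *
  have ht : 0 < m₁ ^ (q - 1) * m₂ ^ (p - 1) := by positivity
  generalize m₁ ^ (q - 1) * m₂ ^ (p - 1) = t at *
  rw [div_le_div_iff₀ (by positivity) (by norm_num)]
  have : 0 < t⁻¹ * X := by positivity
  calc t⁻¹ * (3 / 2 ^ 2 * X ^ 2) * 8 = t⁻¹ * X * (6 * X) := by ring
    _ ≤ t⁻¹ * X * (6 * t + X) := by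
      have : X ≤ t := by
        rw [inv_mul_le_iff₀ ht, mul_one] at h1
        exact h1
      gcongr
      linarith

end RandomAverageSampling

/-! ### The sampling theorem -/

theorem theorem4p1
    {G₁ G₂ : Type*}
    [AddCommGroup G₁] [TopologicalSpace G₁] [IsTopologicalAddGroup G₁] [LocallyCompactSpace G₁]
    [T2Space G₁] [MeasurableSpace G₁] [BorelSpace G₁]
    [AddCommGroup G₂] [TopologicalSpace G₂] [IsTopologicalAddGroup G₂] [LocallyCompactSpace G₂]
    [T2Space G₂] [MeasurableSpace G₂] [BorelSpace G₂]
    (μ₁ : Measure G₁) [μ₁.IsAddHaarMeasure] [μ₁.Regular]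
    (μ₂ : Measure G₂) [μ₂.IsAddHaarMeasure] [μ₂.Regular]
    (p q : ℝ) (hp : 1 < p) (hq : 1 < q)
    -- the separated families of shifts
    {I : Type*} [Countable I] (x : I → G₁) (y : I → G₂)
    (hx : IsSeparatedFamily x) (hy : IsSeparatedFamily y)
    -- the averaging function
    (w : G₁ × G₂ → ℂ) (W₁ : Set G₁) (W₂ : Set G₂) (hw : IsAveragingFunction μ₁ μ₂ w W₁ W₂)
    -- the sampling domain, the enlarged domain, and the generators
    (K₁ : Set G₁) (K₂ : Set G₂) (hK₁ : IsCompact K₁) (hK₂ : IsCompact K₂)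
    (Kt : Set (G₁ × G₂)) (hKt : Kt = (K₁ - W₁) ×ˢ (K₂ - W₂))
    {r : ℕ} (Φ : Fin r → G₁ × G₂ → ℂ) (a₁ a₂ : ℝ)
    (hΦ : HasStableShifts μ₁ μ₂ p q Φ x y (K₁ - W₁) (K₂ - W₂) a₁ a₂)
    (hseq : IsSeqCompact (Kt - ⋃ i, tsupport (Φ i)))
    -- the density
    (ρ : G₁ × G₂ → ℝ) (C₁ C₂ : ℝ) (hρ : IsBoundedDensity μ₁ μ₂ K₁ K₂ ρ C₁ C₂)
    -- the independent identically distributed sampling points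
    {Ω : Type*} [MeasurableSpace Ω] (P : Measure Ω) [IsProbabilityMeasure P]
    (Z : ℕ → ℕ → Ω → G₁ × G₂) (hZ : ∀ j k, Measurable (Z j k))
    (hlaw : ∀ j k, P.map (Z j k) = sampleLaw μ₁ μ₂ K₁ K₂ ρ)
    (hind : iIndepFun (fun jk : ℕ × ℕ => Z jk.1 jk.2) P)
    -- the lower stability bound for the averaged generators
    (β : ℝ) (hβ : 0 < β)
    (hlow : ∀ c ∈ coeffSpace p q Φ x y Kt,
      ENNReal.ofReal β * vecSeqNorm p q c ≤
        mixedNorm μ₁ μ₂ p q K₁ K₂ (shiftSum (fun i => conv μ₁ μ₂ (Φ i) w) x y c))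
    (γ : ℝ) (hγ₀ : 0 < γ) (hγ₁ : γ < 1)
    -- the constants
    (d : ℕ) (hd : d = localDim μ₁ μ₂ p q Φ x y Kt)
    (Ct : ℝ) (hCt : Ct = shiftSup Φ x y Kt)
    (Nw : ℝ) (hNw : Nw = (mixedNorm μ₁ μ₂ 1 1 W₁ W₂ w).toReal)
    (n m : ℕ)
    (hnm : sampleBound p q (μ₁.real K₁) (μ₂.real K₂) a₁ Ct Nw C₁ γ (β / a₂) d < (n : ℝ) * m) :
    ∃ E : Set Ω, MeasurableSet E ∧
      ENNReal.ofReal (1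
          - probConst₁ a₁ Ct d * Real.exp (-((n : ℝ) * m *
              rate₁ p q (μ₁.real K₁) (μ₂.real K₂) a₁ Ct Nw C₁ γ (β / a₂)))
          - probConst₂ a₁ Ct d * Real.exp (-((n : ℝ) * m *
              rate₂ p q (μ₁.real K₁) (μ₂.real K₂) a₁ Ct Nw C₁ γ (β / a₂)))) ≤ P E ∧
      ∀ ξ ∈ E, ∀ z : Fin n → Fin m → G₁ × G₂, (∀ j k, z j k = Z j k ξ) →
        (∀ c : activeFinset Φ x y Kt × Fin r → ℂ,
          samplingMatrix μ₁ μ₂ Φ w x y Kt z *ᵥ c = 0 → c = 0) ∧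
        ∃ h : Fin n → Fin m → G₁ × G₂ → ℂ,
          h = reconFun μ₁ μ₂ Φ w x y Kt z ∧
          ∀ f ∈ localSpace μ₁ μ₂ p q Φ x y Kt, ∀ g ∈ Kt,
            f g = ∑ j, ∑ k, conv μ₁ μ₂ f w (z j k) * h j k g := by

  have hp0 : 0 < p := by linarith
  have hq0 : 0 < q := by linarith
  have hΦc := hΦ.continuous
  have hΦs := hΦ.compactSupport
  have hK₁m := hK₁.measurableSet
  have hK₂m := hK₂.measurableSet
  have : IsFiniteMeasure (μ₁.restrict K₁) := isFiniteMeasure_restrict.2 hK₁.measure_lt_top.ne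
  have : IsFiniteMeasure (μ₂.restrict K₂) := isFiniteMeasure_restrict.2 hK₂.measure_lt_top.ne
  have hA : IsCompact (K₁ - W₁) := by
    rw [sub_eq_add_neg]
    exact hK₁.add hw.compact₁.neg
  have hB : IsCompact (K₂ - W₂) := by
    rw [sub_eq_add_neg]
    exact hK₂.add hw.compact₂.neg
  have hfin : (activeSet Φ x y Kt).Finite :=
    finite_activeSet hx hy hΦs (hKt ▸ hA.prod hB)
  have hKW : ∀ z ∈ K₁ ×ˢ K₂, ∀ ζ ∈ W₁ ×ˢ W₂, z - ζ ∈ Kt := fun z hz ζ hζ => by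
    rw [hKt]
    exact ⟨sub_mem_sub hz.1 hζ.1, sub_mem_sub hz.2 hζ.2⟩
  set J := activeFinset Φ x y Kt with hJ
  set D := Fintype.card (J × Fin r) with hD
  have hDd : D ≤ d := by
    subst hKt
    rw [hd]
    exact card_le_localDim hΦ hA.measurableSet hB.measurableSet hp0 hq0 hfin
  set g := averagedShifts μ₁ μ₂ Φ w x y J with hg
  have hgm : Measurable g := measurable_averagedShifts hw hΦc hΦs J
  set π := sampleLaw μ₁ μ₂ K₁ K₂ ρ with hπ
  have hπprob : IsProbabilityMeasure π := ⟨hρ.total⟩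
  set X := μ₁.real K₁ ^ (1 - q) * μ₂.real K₂ ^ (1 - p) *
    (γ * C₁ * (a₁ * (β / a₂) / (Ct * Nw)) ^ (p * q)) with hX
  have hCt0 : 0 ≤ Ct := hCt ▸ Real.iSup_nonneg fun z =>
    Finset.sum_nonneg fun i _ => tsum_nonneg fun st => norm_nonneg _
  have hNw0 : 0 ≤ Nw := hNw ▸ ENNReal.toReal_nonneg
  -- every nonzero combination is nonzero at a random point with probability at least `X`
  have hnonzero : ∀ a : J × Fin r → ℂ, a ≠ 0 →
      (0 < μ₁.real K₁ ∧ 0 < μ₂.real K₂ ∧ 0 < Ct ∧ 0 < Nw) ∧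
        ENNReal.ofReal X ≤ π {z | a ⬝ᵥ g z ≠ 0} := by
    intro a ha
    have hpow := rpow_le_mul_measureReal_ne_zero hp hq hw hΦc hΦs hK₁m hK₂m hKW hfin hβ hlow ha
    rw [← hCt, ← hNw] at hpow
    obtain ⟨h1, h2, h3, h4, h5⟩ := constants_of_rpow_le hp hq measureReal_nonneg
      measureReal_nonneg hCt0 hNw0 hρ.pos hγ₀ hγ₁ hβ hΦ.pos hΦ.le hpow
    refine ⟨⟨h1, h2, h3, h4⟩, (ENNReal.ofReal_le_ofReal h5).trans ?_⟩
    rw [ENNReal.ofReal_mul hρ.pos.le, ofReal_measureReal]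
    refine hρ.le_sampleLaw hK₁m hK₂m ?_
    have : Measurable fun z => a ⬝ᵥ g z := by
      simp only [dotProduct]
      fun_prop
    exact (measurableSet_singleton (0 : ℂ)).compl.preimage this
  have ha₂ : 0 < a₂ := hΦ.pos.trans_le hΦ.le
  set V : Submodule ℂ (J × Fin r → ℂ) := ⊤ with hV
  -- the tuples of points at which the sampling matrix has a nontrivial kernel
  have hbad : Measure.pi (fun _ : Fin (n * m) => π) (commonKernelSet g V (n * m)) ≤
      ENNReal.ofReal (probConst₁ a₁ Ct d * Real.exp (-((n : ℝ) * m *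
        rate₁ p q (μ₁.real K₁) (μ₂.real K₂) a₁ Ct Nw C₁ γ (β / a₂)))) := by
    by_cases htriv : ∃ a : J × Fin r → ℂ, a ≠ 0
    · obtain ⟨a, ha⟩ := htriv
      obtain ⟨⟨h1, h2, h3, h4⟩, hXa⟩ := hnonzero a ha
      have ha₁ := hΦ.pos
      have hC := hρ.pos
      have hX0 : 0 < X := by positivity
      have hX1 : X ≤ 1 := ENNReal.ofReal_le_one.1 (hXa.trans prob_le_one)
      refine (measure_commonKernelSet_le π hgm hX0.le hX1 (fun a ha => (hnonzero a ha).2)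
        (n * m) V).trans (ENNReal.ofReal_le_ofReal ?_)
      rw [hV, finrank_top, Module.finrank_fintype_fun_eq_card, ← hD, probConst₁, mul_div_assoc 8 Ct a₁]
      have := two_pow_mul_one_sub_pow_le (N := n * m) (κ := Ct / a₁) hDd hX0 hX1 (by positivity) h4
        (rate₁_le h1 h2 hC hγ₀ ha₁ h3 h4 (by positivity) hX1) (by
          rw [sampleBound, thresholdConst_eq ha₁ h3 h4 (by positivity)] at hnm
          exact_mod_cast hnm)
      exact_mod_cast this
    · have : commonKernelSet g V (n * m) = ∅ :=
        eq_empty_of_forall_notMem fun z ⟨c, _, hc, _⟩ => htriv ⟨c, hc⟩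
      simp [this]
  have hA₂ : 0 ≤ probConst₂ a₁ Ct d := by
    have ha₁ := hΦ.pos
    rw [probConst₂]
    positivity
  let e := finProdFinEquiv (m := n) (n := m)
  let pts : Ω → Fin (n * m) → G₁ × G₂ := fun ξ i => Z (e.symm i).1 (e.symm i).2 ξ
  have hpts : Measurable pts := measurable_pi_iff.2 fun i => hZ _ _
  have hptslaw : P.map pts = Measure.pi fun _ => π := by
    have hinj : Function.Injective fun i : Fin (n * m) => ((e.symm i).1.1, (e.symm i).2.1) := by
      intro i i' h
      simp only [Prod.mk.injEq] at h
      exact e.symm.injective (Prod.ext (Fin.ext h.1) (Fin.ext h.2))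
    have := (iIndepFun_iff_map_fun_eq_pi_map fun i => (hZ _ _).aemeasurable).1
      (hind.precomp hinj)
    simpa only [hlaw] using this
  -- the exceptional event: the kernel is nontrivial, or some point misses the sampling domain
  set B := pts ⁻¹' commonKernelSet g V (n * m) with hBdef
  have hBm : MeasurableSet B := hpts (measurableSet_commonKernelSet hgm V _)
  have hPB : P B ≤ ENNReal.ofReal (probConst₁ a₁ Ct d * Real.exp (-((n : ℝ) * m *
      rate₁ p q (μ₁.real K₁) (μ₂.real K₂) a₁ Ct Nw C₁ γ (β / a₂)))) := by
    rw [hBdef, ← Measure.map_apply hpts (measurableSet_commonKernelSet hgm V _), hptslaw]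
    exact hbad
  set O : Set Ω := ⋃ j : Fin n, ⋃ k : Fin m, Z j k ⁻¹' (K₁ ×ˢ K₂)ᶜ with hO
  have hOm : MeasurableSet O :=
    .iUnion fun j => .iUnion fun k => hZ _ _ (hK₁m.prod hK₂m).compl
  have hPO : P O = 0 := by
    refine measure_iUnion_null fun j => measure_iUnion_null fun k => ?_
    rw [← Measure.map_apply (hZ _ _) (hK₁m.prod hK₂m).compl, hlaw]
    exact sampleLaw_compl hK₁m hK₂m
  refine ⟨(B ∪ O)ᶜ, (hBm.union hOm).compl, ?_, ?_⟩
  · rw [prob_compl_eq_one_sub (hBm.union hOm), sub_sub]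
    rw [ENNReal.ofReal_sub _ (by rw [probConst₁]; positivity), ENNReal.ofReal_one]
    refine tsub_le_tsub_left ((measure_union_le _ _).trans ?_) _
    rw [hPO, add_zero]
    exact hPB.trans (ENNReal.ofReal_le_ofReal (le_add_of_nonneg_right (by positivity)))
  · intro ξ hξ z hz
    have hzK : ∀ j k, z j k ∈ K₁ ×ˢ K₂ := fun j k => by
      by_contra h0
      refine hξ (Or.inr (mem_iUnion.2 ⟨j, mem_iUnion.2 ⟨k, ?_⟩⟩))
      rwa [mem_preimage, ← hz]
    have hM : ∀ c, samplingMatrix μ₁ μ₂ Φ w x y Kt z *ᵥ c = 0 → c = 0 := by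
      intro c hc
      by_contra hc0
      refine hξ (Or.inl ⟨c, Submodule.mem_top, hc0, fun i => ?_⟩)
      have := congrFun hc (e.symm i)
      rw [Matrix.mulVec, dotProduct_comm] at this
      simpa [pts, hz, samplingMatrix, g, averagedShifts, dotProduct] using this
    exact ⟨hM, _, rfl, fun f hf v hv => eq_sum_conv_mul_reconFun hw hΦc hΦs hfin
      (fun j k => hKW _ (hzK j k)) hM hf hv⟩
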